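/- Let $K\subseteq\mathbb{R}^2$ be a convex set of area $1$, and let $K_n$ be a set of $n$ points chosen independently and uniformly at random from $K$. A region is called empty (a hole) if no point of $K_n$ lies in its interior. Let $\mathrm{PolyMax}(K_n)$ be the largest area of an empty convex polygon all of whose vertices belong to $K_n$ (and $0$ if there is no such polygon). Then with high probability $$(1+o(1))\,\frac{\log n}{n}\;\le\;\mathrm{PolyMax}(K_n)\;\le\;(4+o(1))\,\frac{\log n}{n},$$ that is, there are deterministic sequences $u_n\to 0$ and $v_n\to 0$ (which may depend on $K$) such that the probability that $(1+u_n)\frac{\log n}{n}\le \mathrm{PolyMax}(K_n)\le (4+v_n)\frac{\log n}{n}$ tends to $1$ as $n\to\infty$. -/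

import Mathlib

open Filter Topology MeasureTheory

noncomputable section

namespace ConvexHoles

/-- The Euclidean plane; its `volume` is the area. -/
abbrev Plane : Type := EuclideanSpace ℝ (Fin 2)

/-- The joint law of `n` points chosen independently and uniformly at random from `K`:
the `n`-fold product of the normalized restriction of the area to `K`. -/
def uniformSample (K : Set Plane) (n : ℕ) : Measure (Fin n → Plane) :=
  Measure.pi fun _ => ProbabilityTheory.cond (volume : Measure Plane) K

/-- `V` is the vertex set of a convex polygon (the convex hull of `V`) whose vertices all belong
to the point set `P`: `V` has at least three points, and they are in convex position. -/
def IsConvexPolygonIn (P : Set Plane) (V : Finset Plane) : Prop :=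
  (V : Set Plane) ⊆ P ∧ 3 ≤ V.card ∧ ConvexIndependent ℝ (fun x : V => (x : Plane))

/-- A region `Q` is a hole with respect to the point set `P` if no point of `P` lies in the
interior of `Q`. -/
def IsHole (P Q : Set Plane) : Prop :=
  Disjoint (interior Q) P

/-- The areas of the empty convex polygons with vertices in `P`. -/
def emptyPolygonAreas (P : Set Plane) : Set ℝ :=
  {a | ∃ V : Finset Plane, IsConvexPolygonIn P V ∧ IsHole P (convexHull ℝ (V : Set Plane)) ∧
    a = volume.real (convexHull ℝ (V : Set Plane))}

/-- For a finite point set there are only finitely many such areas, so that the supremum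
in `polyMax` is a maximum as soon as there is at least one empty convex polygon. -/
theorem emptyPolygonAreas_finite {P : Set Plane} (hP : P.Finite) :
    (emptyPolygonAreas P).Finite := by
  refine ((hP.finite_subsets).image
    (fun W : Set Plane => volume.real (convexHull ℝ W))).subset ?_
  rintro a ⟨V, hV, -, rfl⟩
  exact ⟨(V : Set Plane), hV.1, rfl⟩

/-- The largest area of an empty convex polygon with vertices in `P`
(`0` if there is no such polygon). -/
def polyMax (P : Set Plane) : ℝ :=
  sSup (emptyPolygonAreas P)

/-- The events `E n` hold with high probability: the probability that `E n` fails tends to `0`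
as `n → ∞`. (This is at least as strong as `μ n (E n) → 1`, also without measurability.) -/
def WithHighProbability {Ω : ℕ → Type} [∀ n, MeasurableSpace (Ω n)]
    (μ : ∀ n, Measure (Ω n)) (E : ∀ n, Set (Ω n)) : Prop :=
  Tendsto (fun n => μ n (E n)ᶜ) atTop (𝓝 0)

end ConvexHoles

end

namespace ConvexHoles

open scoped ENNReal

/-! Write L = log n / n. It suffices to bound `polyMax` by (4 + ε)L from above and (1 - ε)L from
below for each fixed ε > 0; `exists_tendsto_zero_diagonal` then lets ε tend to 0 with n.

Upper bound. Let p and q be the leftmost and rightmost vertices of an empty polygon of area at least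
A, and r and s its extreme vertices above and below the line pq. The polygon lies in a parallelogram
with vertical sides through p and q, of which the quadrilateral p r q s covers half, so that
quadrilateral is empty and has area at least A/2. Rounding r and s to a grid of fixed fineness
replaces it by one of N³ kites determined by p and q alone, at an arbitrarily small relative loss of
area (`exists_gridKite_subset`). The other n - 2 points are independent of the kite, so a union
bound gives about n² N³ exp(-nA/2), which tends to 0 for A = (4 + ε)L (`pi_polyMax_gt_le`).

Lower bound. K contains a square, which is cut into about 1/a strips (up to a constant) of area a =
cL with c < 1. A strip is good if its only sample points are four, one in a small rectangle at each
corner; these span an empty quadrilateral of area almost a (`le_polyMax_of_corner_points`). The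
expected number of good patterns is of order n^(1-c) (log n)³, and distinct patterns are almost
uncorrelated, so the second moment method (`pi_no_pattern_le`) produces a good strip with high
probability. -/

/-! ### Probabilistic tools -/

theorem exists_tendsto_zero_diagonal (g : ℝ → ℕ → ℝ≥0∞)
    (h : ∀ ε : ℝ, 0 < ε → Tendsto (g ε) atTop (𝓝 0)) :
    ∃ e : ℕ → ℝ, Tendsto e atTop (𝓝 0) ∧
      Tendsto (fun n => g (e n) n) atTop (𝓝 0) := by
  classical
  let c : ℕ → ℝ := fun k => 1 / ((k : ℝ) + 1)
  have hc : ∀ k, 0 < c k := fun k => Nat.one_div_pos_of_nat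
  have hc0 : Tendsto c atTop (𝓝 0) := tendsto_one_div_add_atTop_nhds_zero_nat
  let P : ℕ → ℕ → Prop := fun n k => g (c k) n ≤ ENNReal.ofReal (c k)
  have hP : ∀ k, ∀ᶠ n in atTop, P n k := fun k =>
    (h (c k) (hc k)).eventually_le_const (ENNReal.ofReal_pos.2 (hc k))
  -- The finest tolerance with index at most n already achieved at time n; each tolerance is
  -- achieved eventually, so the index tends to infinity.
  let κ : ℕ → ℕ := fun n => Nat.findGreatest (P n) n
  have hκ : Tendsto κ atTop atTop := by
    refine tendsto_atTop.2 fun k => ?_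
    filter_upwards [hP k, eventually_ge_atTop k] with n hn hkn
    exact Nat.le_findGreatest hkn hn
  refine ⟨fun n => c (κ n), hc0.comp hκ, ?_⟩
  have hup : Tendsto (fun n => ENNReal.ofReal (c (κ n))) atTop (𝓝 0) := by
    simpa using ENNReal.tendsto_ofReal (hc0.comp hκ)
  refine tendsto_of_tendsto_of_tendsto_of_le_of_le' tendsto_const_nhds hup
    (Eventually.of_forall fun _ => zero_le) ?_
  -- `Nat.findGreatest` defaults to 0 when no index qualifies, so the property at 0 is what makes
  -- its value always qualify.
  filter_upwards [hP 0] with n hn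
  exact Nat.findGreatest_spec (P := P n) (Nat.zero_le n) hn

/-- The second moment method for the union of finitely many equally likely events. -/
theorem measureReal_compl_iUnion_le {Ω ι : Type*} [MeasurableSpace Ω] [Fintype ι] [DecidableEq ι]
    (μ : Measure Ω) [IsProbabilityMeasure μ] (F : ι → Set Ω) (hF : ∀ e, MeasurableSet (F e))
    (π ρ : ℝ) (hπ : 0 < π) (hι : 0 < Fintype.card ι) (hρ : 0 ≤ ρ)
    (h₁ : ∀ e, μ.real (F e) = π)
    (h₂ : ∀ e f, e ≠ f → μ.real (F e ∩ F f) ≤ ρ * π ^ 2) :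
    μ.real (⋃ e, F e)ᶜ ≤ 1 / (Fintype.card ι * π) + (ρ - 1) := by
  set m : ℝ := (Fintype.card ι : ℝ) with hm
  have hm0 : 0 < m := Nat.cast_pos.2 hι
  let I : ι → Ω → ℝ := fun e => (F e).indicator 1
  have hI : ∀ e, Integrable (I e) μ := fun e =>
    (integrable_const (1 : ℝ)).indicator (hF e)
  have hII : ∀ e f, I e * I f = (F e ∩ F f).indicator 1 := fun e f => by
    simp only [I]; rw [Set.inter_indicator_one]
  have hII' : ∀ e f, Integrable (I e * I f) μ := fun e f => by
    rw [hII]; exact (integrable_const (1 : ℝ)).indicator ((hF e).inter (hF f))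
  have hexp : ∀ ω, (∑ e, I e ω - m * π) ^ 2 =
      ∑ e, ∑ f, (I e * I f) ω - 2 * (m * π) * ∑ e, I e ω + (m * π) ^ 2 := fun ω => by
    have : ∑ e, ∑ f, (I e * I f) ω = (∑ e, I e ω) ^ 2 := by
      rw [sq, Finset.sum_mul_sum]; rfl
    rw [this]; ring
  have hi1 : Integrable (fun ω => ∑ e, ∑ f, (I e * I f) ω) μ :=
    integrable_finsetSum _ fun e _ => integrable_finsetSum _ fun f _ => hII' e f
  have hi2 : Integrable (fun ω => 2 * (m * π) * ∑ e, I e ω) μ :=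
    (integrable_finsetSum _ fun e _ => hI e).const_mul _
  have hint : ∫ ω, (∑ e, I e ω - m * π) ^ 2 ∂μ =
      ∑ e, ∑ f, μ.real (F e ∩ F f) - 2 * (m * π) * (m * π) + (m * π) ^ 2 := by
    simp_rw [hexp]
    have e1 : ∫ ω, ∑ e, ∑ f, (I e * I f) ω ∂μ = ∑ e, ∑ f, μ.real (F e ∩ F f) := by
      rw [integral_finsetSum _ fun e _ => integrable_finsetSum _ fun f _ => hII' e f]
      refine Finset.sum_congr rfl fun e _ => ?_
      rw [integral_finsetSum _ fun f _ => hII' e f]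
      refine Finset.sum_congr rfl fun f _ => ?_
      rw [hII, integral_indicator_one ((hF e).inter (hF f))]
    have e2 : ∫ ω, ∑ e, I e ω ∂μ = m * π := by
      rw [integral_finsetSum _ fun e _ => hI e]
      have : ∀ e, ∫ ω, I e ω ∂μ = π := fun e => by
        rw [← h₁ e]; exact integral_indicator_one (hF e)
      simp [this, hm]
    have e3 := integral_add (hi1.sub hi2) (integrable_const (μ := μ) ((m * π) ^ 2))
    simp only [Pi.sub_apply] at e3
    rw [e3, integral_sub hi1 hi2, e1, integral_const_mul, e2]
    simp
  have hsum : ∑ e, ∑ f, μ.real (F e ∩ F f) ≤ m * π + m ^ 2 * (ρ * π ^ 2) := by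
    -- Only the diagonal needs the extra π; allowing ρπ² there too makes the double sum explicit.
    have hb : ∀ e f, μ.real (F e ∩ F f) ≤ (if e = f then π else 0) + ρ * π ^ 2 := fun e f => by
      have : 0 ≤ ρ * π ^ 2 := by positivity
      split_ifs with h
      · subst h; rw [Set.inter_self, h₁]; linarith
      · simpa using h₂ e f h
    refine (Finset.sum_le_sum fun e _ => Finset.sum_le_sum fun f _ => hb e f).trans ?_
    simp only [Finset.sum_add_distrib, Finset.sum_ite_eq, Finset.mem_univ, if_true,
      Finset.sum_const, Finset.card_univ, nsmul_eq_mul, ← hm]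
    apply le_of_eq; ring
  have hNm : MeasurableSet (⋃ e, F e)ᶜ := (MeasurableSet.iUnion hF).compl
  -- Chebyshev: if no event occurs, the count is 0 and deviates from its mean mπ by exactly mπ.
  have hle : (m * π) ^ 2 * μ.real (⋃ e, F e)ᶜ ≤ ∫ ω, (∑ e, I e ω - m * π) ^ 2 ∂μ := by
    have : ∫ ω, (⋃ e, F e)ᶜ.indicator (fun _ => (m * π) ^ 2) ω ∂μ =
        (m * π) ^ 2 * μ.real (⋃ e, F e)ᶜ := by
      rw [integral_indicator_const _ hNm, smul_eq_mul, mul_comm]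
    rw [← this]
    refine integral_mono ((integrable_const _).indicator hNm) ?_ fun ω => ?_
    · simp_rw [hexp]
      exact (hi1.sub hi2).add (integrable_const _)
    · by_cases hω : ω ∈ (⋃ e, F e)ᶜ
      · have : ∀ e, I e ω = 0 := fun e => by
          refine Set.indicator_of_notMem (fun h => hω (Set.mem_iUnion.2 ⟨e, h⟩)) _
        rw [Set.indicator_of_mem hω]; simp [this]
      · rw [Set.indicator_of_notMem hω]; positivity
  have hmπ : 0 < m * π := by positivity
  have : (m * π) ^ 2 * μ.real (⋃ e, F e)ᶜ ≤ (m * π) ^ 2 * (1 / (m * π) + (ρ - 1)) := by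
    have e : (m * π) ^ 2 * (1 / (m * π) + (ρ - 1)) = m * π + (m * π) ^ 2 * (ρ - 1) := by
      field_simp
    rw [e]; nlinarith
  exact le_of_mul_le_mul_left this (by positivity)

/-- If a region depending on two of the sample points has measure at least `a`, then the other
points avoid it with probability at most `(1 - a) ^ (n - 2)`. -/
theorem pi_pair_region_empty_le {X : Type*} [MeasurableSpace X] (μ : Measure X)
    [IsProbabilityMeasure μ] (S : Set ((X × X) × X)) (hS : MeasurableSet S) {n : ℕ}
    (i j : Fin n) (hij : i ≠ j) (a : ℝ≥0∞) :
    Measure.pi (fun _ : Fin n => μ) {p | a ≤ μ (Prod.mk (p i, p j) ⁻¹' S) ∧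
      ∀ l, l ≠ i → l ≠ j → ((p i, p j), p l) ∉ S} ≤ (1 - a) ^ (n - 2) := by
  classical
  -- Fubini over the coordinates i, j and the rest: once the pair is fixed so is the region, and the
  -- other points avoid it independently.
  let q : Fin n → Prop := fun l => l = i ∨ l = j
  let I : {l // q l} := ⟨i, Or.inl rfl⟩
  let J : {l // q l} := ⟨j, Or.inr rfl⟩
  let T : Set (({l // q l} → X) × ({l // ¬ q l} → X)) :=
    {z | a ≤ μ (Prod.mk (z.1 I, z.1 J) ⁻¹' S)} ∩ ⋂ l, {z | ((z.1 I, z.1 J), z.2 l) ∉ S}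
  have hT : MeasurableSet T := by
    refine MeasurableSet.inter ?_ (MeasurableSet.iInter fun l => ?_)
    · have h := measurable_measure_prodMk_left (ν := μ) hS
      have h2 : Measurable fun z : ({l // q l} → X) × ({l // ¬ q l} → X) => (z.1 I, z.1 J) := by
        fun_prop
      exact measurableSet_le measurable_const (h.comp h2)
    · have h2 : Measurable fun z : ({l // q l} → X) × ({l // ¬ q l} → X) =>
          ((z.1 I, z.1 J), z.2 l) := by fun_prop
      exact (h2 hS).compl
  have hmp := measurePreserving_piEquivPiSubtypeProd (fun _ : Fin n => μ) q
  have hpre : {p : Fin n → X | a ≤ μ (Prod.mk (p i, p j) ⁻¹' S) ∧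
      ∀ l, l ≠ i → l ≠ j → ((p i, p j), p l) ∉ S} =
      (MeasurableEquiv.piEquivPiSubtypeProd (fun _ : Fin n => X) q) ⁻¹' T := by
    ext p
    simp only [Set.mem_ofPred_eq, Set.mem_preimage, T, Set.mem_inter_iff, Set.mem_iInter,
      Subtype.forall, q, not_or]
    exact and_congr Iff.rfl ⟨fun h l hl => h l hl.1 hl.2, fun h l h1 h2 => h l ⟨h1, h2⟩⟩
  have hcard : Fintype.card {l // ¬ q l} = n - 2 := by
    rw [Fintype.card_subtype_compl, Fintype.card_fin, Fintype.card_subtype]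
    congr 1
    rw [show Finset.univ.filter q = {i, j} by ext l; simp [q]]
    exact Finset.card_pair hij
  rw [hpre, hmp.measure_preimage hT.nullMeasurableSet, Measure.prod_apply hT]
  have hsec : ∀ x : {l // q l} → X,
      Measure.pi (fun _ : {l // ¬ q l} => μ) (Prod.mk x ⁻¹' T) ≤ (1 - a) ^ (n - 2) := by
    intro x
    by_cases hx : a ≤ μ (Prod.mk (x I, x J) ⁻¹' S)
    · have hm : MeasurableSet (Prod.mk (x I, x J) ⁻¹' S) := measurable_prodMk_left hS
      have : Prod.mk x ⁻¹' T ⊆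
          Set.univ.pi fun _ : {l // ¬ q l} => (Prod.mk (x I, x J) ⁻¹' S)ᶜ := by
        intro z hz l _
        exact Set.mem_iInter.1 hz.2 l
      refine (measure_mono this).trans ?_
      rw [Measure.pi_pi, Finset.prod_const, Finset.card_univ, hcard, prob_compl_eq_one_sub hm]
      exact pow_le_pow_left₀ zero_le (tsub_le_tsub_left hx 1) _
    · have : Prod.mk x ⁻¹' T = ∅ := by
        ext z; simp only [Set.mem_preimage, Set.mem_empty_iff_false, iff_false]
        exact fun hz => hx hz.1
      simp [this]
  refine (lintegral_mono hsec).trans ?_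
  simp

/-! ### Areas in coordinates and kites -/

theorem volume_coords_preimage (S : Set (ℝ × ℝ)) :
    volume {z : Plane | (z 0, z 1) ∈ S} = volume S := by
  have h := (EuclideanSpace.volume_preserving_symm_measurableEquiv_toLp (Fin 2)).trans
    (volume_preserving_finTwoArrow ℝ)
  have := h.measure_preimage_equiv (f := (MeasurableEquiv.toLp 2 (Fin 2 → ℝ)).symm.trans
    MeasurableEquiv.finTwoArrow) S
  rw [← this]
  rfl

theorem volume_box (a b c d : ℝ) :
    volume {z : Plane | z 0 ∈ Set.Ico a b ∧ z 1 ∈ Set.Ico c d} =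
      ENNReal.ofReal (b - a) * ENNReal.ofReal (d - c) := by
  have := volume_coords_preimage (Set.Ico a b ×ˢ Set.Ico c d)
  rw [Measure.volume_eq_prod, Measure.prod_prod, Real.volume_Ico, Real.volume_Ico] at this
  rw [← this]; rfl

/-- The horizontal position of `z` relative to `p` and `q`. -/
noncomputable def frac (p q z : Plane) : ℝ := (z 0 - p 0) / (q 0 - p 0)

/-- The signed vertical distance of `z` from the line through `p` and `q`. -/
noncomputable def rise (p q z : Plane) : ℝ :=
  z 1 - p 1 - (q 1 - p 1) / (q 0 - p 0) * (z 0 - p 0)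

/-- The quadrilaterals with opposite vertices `p` and `q` and with apexes above and below the
line `p q`, as a subset of the space of triples `((p, q), z)`. -/
noncomputable def kite (c₁ d₁ c₂ d₂ β₁ β₂ : ℝ) : Set ((Plane × Plane) × Plane) :=
  {w | (w.1.1 0 < w.1.2 0 ∧ 0 < frac w.1.1 w.1.2 w.2 ∧ frac w.1.1 w.1.2 w.2 < 1) ∧
    (rise w.1.1 w.1.2 w.2 * c₁ < β₁ / (w.1.2 0 - w.1.1 0) * frac w.1.1 w.1.2 w.2 ∧
    rise w.1.1 w.1.2 w.2 * d₁ < β₁ / (w.1.2 0 - w.1.1 0) * (1 - frac w.1.1 w.1.2 w.2)) ∧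
    (-rise w.1.1 w.1.2 w.2 * c₂ < β₂ / (w.1.2 0 - w.1.1 0) * frac w.1.1 w.1.2 w.2 ∧
    -rise w.1.1 w.1.2 w.2 * d₂ < β₂ / (w.1.2 0 - w.1.1 0) * (1 - frac w.1.1 w.1.2 w.2))}

theorem measurableSet_kite (c₁ d₁ c₂ d₂ β₁ β₂ : ℝ) :
    MeasurableSet (kite c₁ d₁ c₂ d₂ β₁ β₂) := by
  have hc : ∀ i : Fin 2, Measurable fun z : Plane => z i := fun i => by fun_prop
  have hp : ∀ i : Fin 2, Measurable fun w : (Plane × Plane) × Plane => w.1.1 i :=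
    fun i => (hc i).comp (measurable_fst.comp measurable_fst)
  have hq : ∀ i : Fin 2, Measurable fun w : (Plane × Plane) × Plane => w.1.2 i :=
    fun i => (hc i).comp (measurable_snd.comp measurable_fst)
  have hz : ∀ i : Fin 2, Measurable fun w : (Plane × Plane) × Plane => w.2 i :=
    fun i => (hc i).comp measurable_snd
  have hd : Measurable fun w : (Plane × Plane) × Plane => w.1.2 0 - w.1.1 0 := (hq 0).sub (hp 0)
  have hf : Measurable fun w : (Plane × Plane) × Plane => frac w.1.1 w.1.2 w.2 :=
    ((hz 0).sub (hp 0)).div hd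
  have hr : Measurable fun w : (Plane × Plane) × Plane => rise w.1.1 w.1.2 w.2 :=
    ((hz 1).sub (hp 1)).sub ((((hq 1).sub (hp 1)).div hd).mul ((hz 0).sub (hp 0)))
  refine (((measurableSet_lt (hp 0) (hq 0)).inter ((measurableSet_lt measurable_const hf).inter
    (measurableSet_lt hf measurable_const)))).inter (MeasurableSet.inter ?_ ?_)
  · exact (measurableSet_lt (hr.mul_const _) ((measurable_const.div hd).mul hf)).inter
      (measurableSet_lt (hr.mul_const _) ((measurable_const.div hd).mul (measurable_const.sub hf)))
  · exact (measurableSet_lt (hr.neg.mul_const _) ((measurable_const.div hd).mul hf)).inter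
      (measurableSet_lt (hr.neg.mul_const _)
        ((measurable_const.div hd).mul (measurable_const.sub hf)))

theorem isOpen_kite_section (c₁ d₁ c₂ d₂ β₁ β₂ : ℝ) (p q : Plane) :
    IsOpen (Prod.mk (p, q) ⁻¹' kite c₁ d₁ c₂ d₂ β₁ β₂) := by
  have hf : Continuous fun z : Plane => frac p q z := by unfold frac; fun_prop
  have hr : Continuous fun z : Plane => rise p q z := by unfold rise; fun_prop
  have key : ∀ g : Plane → ℝ, Continuous g → ∀ c d β : ℝ,
      IsOpen {z | g z * c < β * frac p q z ∧ g z * d < β * (1 - frac p q z)} :=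
    fun g hg c d β => (isOpen_lt (hg.mul_const c) (hf.const_mul β)).inter
      (isOpen_lt (hg.mul_const d) ((continuous_const.sub hf).const_mul β))
  exact ((isOpen_const (p := p 0 < q 0)).inter ((isOpen_lt continuous_const hf).inter
    (isOpen_lt hf continuous_const))).inter
      ((key _ hr c₁ d₁ (β₁ / (q 0 - p 0))).inter (key _ hr.neg c₂ d₂ (β₂ / (q 0 - p 0))))

/-- The graph is a triangle over the unit interval with apex at c/(c + d) and height 1/(c + d). -/
theorem integral_tent {c d : ℝ} (hc : 0 < c) (hd : 0 < d) :
    ∫ t in (0 : ℝ)..1, min (t / c) ((1 - t) / d) = 1 / (2 * (c + d)) := by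
  have hcont : Continuous fun t : ℝ => min (t / c) ((1 - t) / d) := by fun_prop
  have ha0 : 0 ≤ c / (c + d) := by positivity
  have ha1 : c / (c + d) ≤ 1 := (div_le_one (by positivity)).2 (by linarith)
  rw [← intervalIntegral.integral_add_adjacent_intervals
    (hcont.intervalIntegrable 0 (c / (c + d))) (hcont.intervalIntegrable (c / (c + d)) 1)]
  have h1 : ∫ t in (0 : ℝ)..(c / (c + d)), min (t / c) ((1 - t) / d) =
      ∫ t in (0 : ℝ)..(c / (c + d)), t / c := by
    refine intervalIntegral.integral_congr fun t ht => ?_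
    rw [Set.uIcc_of_le ha0] at ht
    have := (le_div_iff₀ (by positivity : 0 < c + d)).1 ht.2
    refine min_eq_left ?_
    rw [div_le_div_iff₀ hc hd]; nlinarith
  have h2 : ∫ t in (c / (c + d))..1, min (t / c) ((1 - t) / d) =
      ∫ t in (c / (c + d))..1, (1 - t) / d := by
    refine intervalIntegral.integral_congr fun t ht => ?_
    rw [Set.uIcc_of_le ha1] at ht
    have := (div_le_iff₀ (by positivity : 0 < c + d)).1 ht.1
    refine min_eq_right ?_
    rw [div_le_div_iff₀ hd hc]; nlinarith
  rw [h1, h2, intervalIntegral.integral_div, intervalIntegral.integral_div, integral_id,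
    intervalIntegral.integral_sub (by simp) (by simp), integral_id]
  simp only [intervalIntegral.integral_const, smul_eq_mul]
  field_simp
  ring

/-- The heights are scaled by the inverse of the horizontal width of the kite, so the area does not
depend on p and q. -/
theorem volume_kite_section {c₁ d₁ c₂ d₂ β₁ β₂ : ℝ} (hc₁ : 0 < c₁) (hd₁ : 0 < d₁) (hc₂ : 0 < c₂)
    (hd₂ : 0 < d₂) (hβ₁ : 0 ≤ β₁) (hβ₂ : 0 ≤ β₂) {p q : Plane} (hpq : p 0 < q 0) :
    volume (Prod.mk (p, q) ⁻¹' kite c₁ d₁ c₂ d₂ β₁ β₂) =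
      ENNReal.ofReal (β₁ / (2 * (c₁ + d₁)) + β₂ / (2 * (c₂ + d₂))) := by
  have hw : 0 < q 0 - p 0 := sub_pos.2 hpq
  set w := q 0 - p 0 with hw_def
  let line : ℝ → ℝ := fun x => p 1 + (q 1 - p 1) / w * (x - p 0)
  let tent : ℝ → ℝ → ℝ → ℝ := fun c d x => min (x / c) ((1 - x) / d)
  let t : ℝ → ℝ := fun x => x / w - p 0 / w
  let f : ℝ → ℝ := fun x => line x - β₂ / w * tent c₂ d₂ (t x)
  let g : ℝ → ℝ := fun x => line x + β₁ / w * tent c₁ d₁ (t x)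
  have htent : ∀ c d, Continuous (tent c d) := fun c d => by simp only [tent]; fun_prop
  have ht : Continuous t := by simp only [t]; fun_prop
  have hline : Continuous line := by simp only [line]; fun_prop
  have hf : Continuous f := hline.sub (continuous_const.mul ((htent _ _).comp ht))
  have hg : Continuous g := hline.add (continuous_const.mul ((htent _ _).comp ht))
  have hset : Prod.mk (p, q) ⁻¹' kite c₁ d₁ c₂ d₂ β₁ β₂ =
      {z : Plane | (z 0, z 1) ∈ regionBetween f g (Set.Ioo (p 0) (q 0))} := by
    ext z
    have hfr : frac p q z = t (z 0) := by simp only [frac, t, ← hw_def]; rw [sub_div]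
    have hri : rise p q z = z 1 - line (z 0) := by simp only [rise, line, ← hw_def]; ring
    have h01 : (0 < t (z 0) ↔ p 0 < z 0) ∧ (t (z 0) < 1 ↔ z 0 < q 0) := by
      simp only [t, ← sub_div]
      constructor
      · rw [div_pos_iff_of_pos_right hw, sub_pos]
      · rw [div_lt_one hw, hw_def, sub_lt_sub_iff_right]
    have key : ∀ {c d β x h : ℝ}, 0 < c → 0 < d →
        (h < β * tent c d x ∧ 0 ≤ β ↔ (h * c < β * x ∧ h * d < β * (1 - x)) ∧ 0 ≤ β) := by
      intro c d β x h hc hd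
      refine and_congr_left fun hβ => ?_
      simp only [tent]
      rw [mul_min_of_nonneg _ _ hβ, lt_min_iff, ← mul_div_assoc, ← mul_div_assoc,
        lt_div_iff₀ hc, lt_div_iff₀ hd]
    have hB₁ : 0 ≤ β₁ / w := by positivity
    have hB₂ : 0 ≤ β₂ / w := by positivity
    have k1 := key (β := β₁ / w) (x := t (z 0)) (h := z 1 - line (z 0)) hc₁ hd₁
    have k2 := key (β := β₂ / w) (x := t (z 0)) (h := -(z 1 - line (z 0))) hc₂ hd₂
    simp only [hB₁, hB₂, and_true] at k1 k2
    simp only [kite, Set.mem_preimage, Set.mem_ofPred_eq, regionBetween, hfr, hri, ← hw_def,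
      ← k1, ← k2, Set.mem_Ioo, f, g, h01.1, h01.2, hpq, true_and]
    refine and_congr_right fun _ => ?_
    constructor
    · rintro ⟨h1, h2⟩; exact ⟨by linarith, by linarith⟩
    · rintro ⟨h1, h2⟩; exact ⟨by linarith, by linarith⟩
  rw [hset, volume_coords_preimage, Measure.volume_eq_prod]
  have hnonneg : ∀ {c d x : ℝ}, 0 < c → 0 < d → x ∈ Set.Ioo (p 0) (q 0) → 0 ≤ tent c d (t x) := by
    intro c d x hc hd hx
    have h0 : 0 ≤ t x := by
      simp only [t, ← sub_div]; exact div_nonneg (by linarith [hx.1]) hw.le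
    have h1 : t x ≤ 1 := by
      simp only [t, ← sub_div]; exact (div_le_one hw).2 (by linarith [hx.2])
    exact le_min (div_nonneg h0 hc.le) (div_nonneg (by linarith) hd.le)
  rw [volume_regionBetween_eq_integral
    (hf.continuousOn.integrableOn_Icc.mono_set Set.Ioo_subset_Icc_self)
    (hg.continuousOn.integrableOn_Icc.mono_set Set.Ioo_subset_Icc_self) measurableSet_Ioo]
  · congr 1
    rw [← integral_Ioc_eq_integral_Ioo, ← intervalIntegral.integral_of_le hpq.le]
    have : ∀ x, (g - f) x = β₁ / w * tent c₁ d₁ (x / w - p 0 / w) +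
        β₂ / w * tent c₂ d₂ (x / w - p 0 / w) := fun x => by
      simp only [Pi.sub_apply, f, g, t]; ring
    simp_rw [this]
    have hi : ∀ c d, IntervalIntegrable (fun x => tent c d (x / w - p 0 / w)) volume (p 0) (q 0) :=
      fun c d => ((htent c d).comp ht).intervalIntegrable _ _
    rw [intervalIntegral.integral_add ((hi _ _).const_mul _) ((hi _ _).const_mul _),
      intervalIntegral.integral_const_mul, intervalIntegral.integral_const_mul,
      intervalIntegral.integral_comp_div_sub _ hw.ne', intervalIntegral.integral_comp_div_sub _ hw.ne',
      sub_self, ← sub_div, div_self hw.ne', integral_tent hc₁ hd₁, integral_tent hc₂ hd₂]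
    simp only [smul_eq_mul]
    field_simp
  · intro x hx
    have h1 := mul_nonneg (div_nonneg hβ₁ hw.le) (hnonneg hc₁ hd₁ hx)
    have h2 := mul_nonneg (div_nonneg hβ₂ hw.le) (hnonneg hc₂ hd₂ hx)
    simp only [f, g]; linarith

/-! ### A quadrilateral with half the area of a convex polygon -/

theorem rise_left (p q : Plane) : rise p q p = 0 := by simp [rise]

theorem convex_setOf_rise_le (p q : Plane) (a : ℝ) :
    Convex ℝ {z : Plane | rise p q z ≤ a} ∧ Convex ℝ {z : Plane | a ≤ rise p q z} := by
  have key : ∀ x y : Plane, ∀ s t : ℝ, s + t = 1 →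
      rise p q (s • x + t • y) = s * rise p q x + t * rise p q y := by
    intro x y s t hst
    have : t = 1 - s := by linarith
    subst this
    simp only [rise, PiLp.add_apply, PiLp.smul_apply, smul_eq_mul]; ring
  constructor
  · intro x hx y hy s t hs ht hst
    simp only [Set.mem_ofPred_eq] at *
    rw [key x y s t hst]
    have h : s * a + t * a = a := by rw [← add_mul, hst, one_mul]
    nlinarith [mul_le_mul_of_nonneg_left hx hs, mul_le_mul_of_nonneg_left hy ht]
  · intro x hx y hy s t hs ht hst
    simp only [Set.mem_ofPred_eq] at *
    rw [key x y s t hst]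
    have h : s * a + t * a = a := by rw [← add_mul, hst, one_mul]
    nlinarith [mul_le_mul_of_nonneg_left hx hs, mul_le_mul_of_nonneg_left hy ht]

theorem convex_setOf_coord (i : Fin 2) (a b : ℝ) :
    Convex ℝ {z : Plane | z i ∈ Set.Icc a b} :=
  (convex_Icc a b).is_linear_preimage (f := fun z : Plane => z i)
    ⟨fun _ _ => rfl, fun _ _ => rfl⟩

theorem volume_strip_le (p q : Plane) {H₁ H₂ : ℝ} (h : 0 ≤ H₁ + H₂) (hpq : p 0 ≤ q 0) :
    volume {z : Plane | z 0 ∈ Set.Icc (p 0) (q 0) ∧ -H₂ < rise p q z ∧ rise p q z < H₁} =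
      ENNReal.ofReal ((q 0 - p 0) * (H₁ + H₂)) := by
  let line : ℝ → ℝ := fun x => p 1 + (q 1 - p 1) / (q 0 - p 0) * (x - p 0)
  have hline : Continuous line := by simp only [line]; fun_prop
  have hset : {z : Plane | z 0 ∈ Set.Icc (p 0) (q 0) ∧ -H₂ < rise p q z ∧ rise p q z < H₁} =
      {z : Plane | (z 0, z 1) ∈
        regionBetween (fun x => line x - H₂) (fun x => line x + H₁) (Set.Icc (p 0) (q 0))} := by
    ext z
    have hri : rise p q z = z 1 - line (z 0) := by simp only [rise, line]; ring
    simp only [regionBetween, Set.mem_ofPred_eq, hri, Set.mem_Ioo]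
    refine and_congr_right fun _ => ?_
    constructor
    · rintro ⟨h1, h2⟩; exact ⟨by linarith, by linarith⟩
    · rintro ⟨h1, h2⟩; exact ⟨by linarith, by linarith⟩
  rw [hset, volume_coords_preimage, Measure.volume_eq_prod, volume_regionBetween_eq_integral
    (f := fun x => line x - H₂) (g := fun x => line x + H₁)
    (hline.sub continuous_const).continuousOn.integrableOn_Icc
    (hline.add continuous_const).continuousOn.integrableOn_Icc measurableSet_Icc
    (fun x _ => by linarith)]
  congr 1
  have : ∀ x, ((fun x => line x + H₁) - fun x => line x - H₂) x = H₁ + H₂ := fun x => by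
    simp only [Pi.sub_apply]; ring
  simp_rw [this]
  simp [hpq]

/-- The last bound says that the parallelogram around the polygon, with vertical sides through p and
q and the other sides through r and s parallel to pq, has area at least A; the quadrilateral p r q s
has half that area. -/
theorem exists_extremal_quadrilateral (V : Finset Plane) (hV : V.Nonempty) {A : ℝ} (hA : 0 < A)
    (hAV : A ≤ volume.real (convexHull ℝ (V : Set Plane))) :
    ∃ p ∈ V, ∃ q ∈ V, ∃ r ∈ V, ∃ s ∈ V, p 0 < q 0 ∧ r 0 ∈ Set.Icc (p 0) (q 0) ∧
      s 0 ∈ Set.Icc (p 0) (q 0) ∧ 0 ≤ rise p q r ∧ rise p q s ≤ 0 ∧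
      A ≤ (q 0 - p 0) * (rise p q r - rise p q s) := by
  obtain ⟨p, hp, hpm⟩ := V.exists_min_image (fun z => z 0) hV
  obtain ⟨q, hq, hqm⟩ := V.exists_max_image (fun z => z 0) hV
  obtain ⟨r, hr, hrm⟩ := V.exists_max_image (fun z => rise p q z) hV
  obtain ⟨s, hs, hsm⟩ := V.exists_min_image (fun z => rise p q z) hV
  have hr0 : 0 ≤ rise p q r := rise_left p q ▸ hrm p hp
  have hs0 : rise p q s ≤ 0 := by simpa [rise_left] using hsm p hp
  have hpq : p 0 ≤ q 0 := hpm q hq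
  -- The strip of `volume_strip_le` is open in the vertical direction, so it is widened by δ on both
  -- sides and δ is sent to 0 afterwards.
  have hbound : ∀ δ : ℝ, 0 < δ → A ≤ (q 0 - p 0) * (rise p q r - rise p q s + 2 * δ) := by
    intro δ hδ
    have hsub : convexHull ℝ (V : Set Plane) ⊆
        {z : Plane | z 0 ∈ Set.Icc (p 0) (q 0)} ∩ ({z : Plane | rise p q z ≤ rise p q r} ∩
          {z : Plane | rise p q s ≤ rise p q z}) :=
      convexHull_min (fun z hz => ⟨⟨hpm z hz, hqm z hz⟩, hrm z hz, hsm z hz⟩)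
        ((convex_setOf_coord 0 _ _).inter
          ((convex_setOf_rise_le p q _).1.inter (convex_setOf_rise_le p q _).2))
    have hsub' : convexHull ℝ (V : Set Plane) ⊆ {z : Plane | z 0 ∈ Set.Icc (p 0) (q 0) ∧
        -(δ - rise p q s) < rise p q z ∧ rise p q z < rise p q r + δ} := fun z hz => by
      obtain ⟨h1, h2, h3⟩ := hsub hz
      simp only [Set.mem_ofPred_eq] at h2 h3
      exact ⟨h1, by linarith, by linarith⟩
    have hvol := volume_strip_le p q (H₁ := rise p q r + δ) (H₂ := δ - rise p q s)
      (by linarith) hpq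
    have hm := measure_mono (μ := volume) hsub'
    rw [hvol] at hm
    refine hAV.trans ((ENNReal.toReal_mono ENNReal.ofReal_ne_top hm).trans ?_)
    rw [ENNReal.toReal_ofReal (mul_nonneg (by linarith) (by linarith))]
    apply le_of_eq; ring
  have hfin : A ≤ (q 0 - p 0) * (rise p q r - rise p q s) := by
    refine le_of_forall_pos_le_add fun ε hε => ?_
    have hw : 0 ≤ q 0 - p 0 := by linarith
    -- The summand 1 keeps δ finite while width 0 is not yet excluded; positivity of A excludes it
    -- below.
    refine (hbound (ε / (2 * (q 0 - p 0 + 1))) (by positivity)).trans ?_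
    have : (q 0 - p 0) * (2 * (ε / (2 * (q 0 - p 0 + 1)))) ≤ ε := by
      rw [show (q 0 - p 0) * (2 * (ε / (2 * (q 0 - p 0 + 1)))) =
        ε * ((q 0 - p 0) / (q 0 - p 0 + 1)) by field_simp]
      exact mul_le_of_le_one_right hε.le ((div_le_one (by linarith)).2 (by linarith))
    rw [mul_add]; linarith
  refine ⟨p, hp, q, hq, r, hr, s, hs, ?_, ⟨hpm r hr, hqm r hr⟩, ⟨hpm s hs, hqm s hs⟩, hr0, hs0,
    hfin⟩
  rcases hpq.lt_or_eq with h | h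
  · exact h
  · rw [h, sub_self, zero_mul] at hfin; linarith

/-- Barycentric coordinates: κ at r, `frac p q z - κ * frac p q r` at q, the rest at p. The
hypotheses `h1` and `h2` are nonnegativity of the weights at q and p. -/
theorem mem_convexHull_triangle {p q r z : Plane} {S : Set Plane} (hp : p ∈ S) (hq : q ∈ S)
    (hr : r ∈ S) (hpq : p 0 < q 0) {κ : ℝ} (hκ : 0 ≤ κ) (hz : rise p q z = κ * rise p q r)
    (h1 : κ * frac p q r ≤ frac p q z) (h2 : κ * (1 - frac p q r) ≤ 1 - frac p q z) :
    z ∈ convexHull ℝ S := by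
  have hw : q 0 - p 0 ≠ 0 := (sub_pos.2 hpq).ne'
  have h := (convex_convexHull ℝ S).sum_mem (t := Finset.univ)
    (w := ![1 - κ - (frac p q z - κ * frac p q r), frac p q z - κ * frac p q r, κ])
    (z := ![p, q, r]) (fun i _ => by fin_cases i <;> simp <;> nlinarith)
    (by simp [Fin.sum_univ_three])
    (fun i _ => by
      fin_cases i
      · exact subset_convexHull ℝ S hp
      · exact subset_convexHull ℝ S hq
      · exact subset_convexHull ℝ S hr)
  convert h using 1
  simp only [rise, frac] at *
  set u := z 0 - p 0 with hu
  set v := r 0 - p 0 with hv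
  set w := q 0 - p 0 with hw_def
  ext i
  fin_cases i
  · simp [Fin.sum_univ_three]
    have e : z 0 = p 0 + u := by rw [hu]; ring
    have e2 : q 0 = p 0 + w := by rw [hw_def]; ring
    have e3 : r 0 = p 0 + v := by rw [hv]; ring
    rw [e, e2, e3]
    field_simp
    ring
  · simp [Fin.sum_univ_three]
    field_simp at hz ⊢
    linear_combination hz

/-! ### Kites with discretized apexes -/

theorem exists_nat_div_le_le {N : ℕ} (hN : 0 < N) {x : ℝ} (h0 : 0 ≤ x) (h1 : x ≤ 1) :
    ∃ k : Fin N, (k : ℝ) / N ≤ x ∧ x ≤ ((k : ℝ) + 1) / N := by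
  have hN' : (0 : ℝ) < N := Nat.cast_pos.2 hN
  rcases h1.lt_or_eq with h | rfl
  · have hlt : ⌊x * N⌋₊ < N := by
      rw [Nat.floor_lt (by positivity)]; nlinarith
    refine ⟨⟨_, hlt⟩, ?_, ?_⟩
    · rw [div_le_iff₀ hN']; exact Nat.floor_le (by positivity)
    · rw [le_div_iff₀ hN']; exact (Nat.lt_floor_add_one _).le
  -- At x = 1 the floor would be N, outside `Fin N`; the last grid cell contains x as well.
  · refine ⟨⟨N - 1, by omega⟩, ?_, ?_⟩
    · rw [div_le_one hN']; exact_mod_cast Nat.sub_le N 1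
    · rw [le_div_iff₀ hN']; push_cast [Nat.cast_sub hN]; linarith

/-- The kites of a fixed area whose apexes have discretized coordinates. -/
noncomputable def gridKite (N : ℕ) (A : ℝ) (k : Fin N × Fin N × Fin N) :
    Set ((Plane × Plane) × Plane) :=
  kite (((k.1 : ℝ) + 1) / N) (((N : ℝ) - k.1) / N) (((k.2.1 : ℝ) + 1) / N)
    (((N : ℝ) - k.2.1) / N) (A * (k.2.2 / N)) (A * ((N - 1 - k.2.2) / N))

theorem volume_gridKite_section {N : ℕ} {A : ℝ} (hA : 0 ≤ A) (k : Fin N × Fin N × Fin N)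
    {p q : Plane} (hpq : p 0 < q 0) :
    volume (Prod.mk (p, q) ⁻¹' gridKite N A k) =
      ENNReal.ofReal (A / 2 * ((N - 1) / (N + 1))) := by
  have hlt : ∀ k : Fin N, ((k : ℕ) : ℝ) + 1 ≤ N := fun k => by exact_mod_cast k.2
  have hN : (0 : ℝ) < N := by linarith [hlt k.1, (Nat.cast_nonneg (k.1 : ℕ) : (0 : ℝ) ≤ (k.1 : ℕ))]
  have hk : ∀ k : Fin N, 0 < (N : ℝ) - k := fun k => by linarith [hlt k]
  have h3 : 0 ≤ (N : ℝ) - 1 - k.2.2 := by linarith [hlt k.2.2]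
  rw [gridKite, volume_kite_section (by positivity) (div_pos (hk _) hN) (by positivity)
    (div_pos (hk _) hN) (by positivity) (mul_nonneg hA (div_nonneg h3 hN.le)) hpq]
  congr 1
  have e : ∀ x : ℝ, (x + 1) / N + (N - x) / N = (N + 1) / N := fun x => by ring
  rw [e, e]
  field_simp
  ring

/-- All rounding shrinks the kite: an apex at position α gets slopes with c ≥ α and d ≥ 1 - α, where
c + d = 1 + 1/N, and both heights are rounded down. -/
theorem exists_gridKite_subset (V : Finset Plane) (hV : V.Nonempty) {A : ℝ} (hA : 0 < A)
    (hAV : A ≤ volume.real (convexHull ℝ (V : Set Plane))) {N : ℕ} (hN : 0 < N) :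
    ∃ p ∈ V, ∃ q ∈ V, p 0 < q 0 ∧ ∃ k : Fin N × Fin N × Fin N,
      Prod.mk (p, q) ⁻¹' gridKite N A k ⊆ convexHull ℝ (V : Set Plane) := by
  obtain ⟨p, hp, q, hq, r, hr, s, hs, hpq, hr0, hs0, h₁, h₂, hle⟩ :=
    exists_extremal_quadrilateral V hV hA hAV
  have hw : 0 < q 0 - p 0 := sub_pos.2 hpq
  have hN' : (0 : ℝ) < N := Nat.cast_pos.2 hN
  have hfr : ∀ z : Plane, z 0 ∈ Set.Icc (p 0) (q 0) → 0 ≤ frac p q z ∧ frac p q z ≤ 1 :=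
    fun z hz => ⟨div_nonneg (by linarith [hz.1]) hw.le, (div_le_one hw).2 (by linarith [hz.2])⟩
  have hH : 0 < rise p q r - rise p q s := by
    by_contra hcon
    nlinarith
  obtain ⟨k₁, hk₁, hk₁'⟩ := exists_nat_div_le_le hN (hfr r hr0).1 (hfr r hr0).2
  obtain ⟨k₂, hk₂, hk₂'⟩ := exists_nat_div_le_le hN (hfr s hs0).1 (hfr s hs0).2
  -- The upper apex has a share of the total height between j/N and (j + 1)/N, so the lower one has
  -- at least (N - 1 - j)/N; just one grid step is lost in total.
  obtain ⟨j, hj, hj'⟩ := exists_nat_div_le_le hN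
    (x := rise p q r / (rise p q r - rise p q s)) (div_nonneg h₁ hH.le)
    ((div_le_one hH).2 (by linarith))
  refine ⟨p, hp, q, hq, hpq, (k₁, k₂, j), ?_⟩
  have hb₁ : A * (j / N) / (q 0 - p 0) ≤ rise p q r := by
    rw [div_le_iff₀ hw]
    rw [le_div_iff₀ hH] at hj
    have hj0 : (0 : ℝ) ≤ j / N := by positivity
    calc A * (j / N) ≤ (q 0 - p 0) * (rise p q r - rise p q s) * (j / N) := by gcongr
      _ = (q 0 - p 0) * (j / N * (rise p q r - rise p q s)) := by ring
      _ ≤ (q 0 - p 0) * rise p q r := by gcongr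
      _ = _ := by ring
  have hb₂ : A * ((N - 1 - j) / N) / (q 0 - p 0) ≤ -rise p q s := by
    rw [div_le_iff₀ hw]
    rw [div_le_iff₀ hH] at hj'
    have hj0 : (0 : ℝ) ≤ (N - 1 - j) / N := by
      have : ((j : ℕ) : ℝ) + 1 ≤ N := by exact_mod_cast j.2
      exact div_nonneg (by linarith) hN'.le
    have e : ((N : ℝ) - 1 - j) / N = 1 - (j + 1) / N := by field_simp; ring
    calc A * ((N - 1 - j) / N)
        ≤ (q 0 - p 0) * (rise p q r - rise p q s) * ((N - 1 - j) / N) := by gcongr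
      _ = (q 0 - p 0) * ((rise p q r - rise p q s) -
            (j + 1) / N * (rise p q r - rise p q s)) := by rw [e]; ring
      _ ≤ (q 0 - p 0) * (-rise p q s) := by gcongr; linarith
      _ = _ := by ring
  rintro z ⟨⟨-, ht0, ht1⟩, ⟨hu1, hu2⟩, ⟨hl1, hl2⟩⟩
  simp only at ht0 ht1 hu1 hu2 hl1 hl2
  have hd : ∀ k : ℕ, ((N : ℝ) - k) / N = 1 - k / N := fun k => by field_simp
  rw [hd] at hu2 hl2
  -- One side of the line pq, with y the distance to it and H the true apex height. A side of height
  -- 0 contains no kite point, whence `0 < H`.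
  have aux : ∀ {H y b c c' t α : ℝ}, 0 ≤ y → b ≤ H → α ≤ c → c' ≤ α → y * c < b * t →
      y * (1 - c') < b * (1 - t) → 0 < t → t < 1 → 0 ≤ α → α ≤ 1 →
      0 < H ∧ y / H * α ≤ t ∧ y / H * (1 - α) ≤ 1 - t := by
    intro H y b c c' t α hy hbH hαc hcα h1 h2 ht0 ht1 hα0 hα1
    have hb : 0 < b := by
      by_contra hcon
      have : 0 ≤ y * c := mul_nonneg hy (by linarith)
      nlinarith
    have hH : 0 < H := by linarith
    refine ⟨hH, ?_, ?_⟩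
    · rw [div_mul_eq_mul_div, div_le_iff₀ hH]; nlinarith
    · rw [div_mul_eq_mul_div, div_le_iff₀ hH]; nlinarith
  rcases le_total 0 (rise p q z) with hz | hz
  · obtain ⟨hpos, g1, g2⟩ := aux hz hb₁ hk₁' hk₁ hu1 hu2 ht0 ht1 (hfr r hr0).1 (hfr r hr0).2
    exact mem_convexHull_triangle (Finset.mem_coe.2 hp) hq hr hpq (div_nonneg hz hpos.le)
      (div_mul_cancel₀ _ hpos.ne').symm g1 g2
  · obtain ⟨hpos, g1, g2⟩ := aux (neg_nonneg.2 hz) hb₂ hk₂' hk₂ hl1 hl2 ht0 ht1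
      (hfr s hs0).1 (hfr s hs0).2
    rw [neg_div_neg_eq] at g1 g2
    have hneg : rise p q s < 0 := by linarith
    exact mem_convexHull_triangle (Finset.mem_coe.2 hp) hq hs hpq
      (div_nonneg_of_nonpos hz hneg.le) (div_mul_cancel₀ _ hneg.ne).symm g1 g2

/-! ### Upper bound by a union bound over pairs and kites -/

theorem cond_volume_eq_restrict {K : Set Plane} (hK : volume K = 1) :
    ProbabilityTheory.cond (volume : Measure Plane) K = volume.restrict K := by
  simp [ProbabilityTheory.cond, hK]

/-- K need not be Borel, but convexity makes it null measurable, which suffices. -/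
theorem pi_restrict_exists_notMem {K : Set Plane} (hK : Convex ℝ K) (hKarea : volume K = 1)
    (n : ℕ) :
    Measure.pi (fun _ : Fin n => (volume : Measure Plane).restrict K) {p | ∃ l, p l ∉ K} = 0 := by
  have : IsProbabilityMeasure ((volume : Measure Plane).restrict K) := ⟨by simpa using hKarea⟩
  have h : ∀ l : Fin n,
      ∀ᵐ p ∂Measure.pi (fun _ : Fin n => (volume : Measure Plane).restrict K), p l ∈ K :=
    fun l => (Measure.quasiMeasurePreserving_eval _ l).ae
      (ae_restrict_mem₀ (hK.nullMeasurableSet volume))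
  have h' := ae_all_iff.2 h
  rw [ae_iff] at h'
  simpa using h'

/-- By convexity the kite lies in K, so restricting the measure costs it no area; being open, it
lies in the interior of the polygon, so it contains no sample point. -/
theorem polyMax_gt_subset {K : Set Plane} (hK : Convex ℝ K) {A : ℝ} (hA : 0 < A) {N : ℕ}
    (hN : 0 < N) (n : ℕ) :
    {p : Fin n → Plane | polyMax (Set.range p) ≤ A}ᶜ ⊆ {p | ∃ l, p l ∉ K} ∪
      ⋃ i : Fin n, ⋃ j : Fin n, ⋃ _ : i ≠ j, ⋃ k : Fin N × Fin N × Fin N,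
        {p | ENNReal.ofReal (A / 2 * ((N - 1) / (N + 1))) ≤
            volume.restrict K (Prod.mk (p i, p j) ⁻¹' gridKite N A k) ∧
          ∀ l, l ≠ i → l ≠ j → ((p i, p j), p l) ∉ gridKite N A k} := by
  intro p hp
  by_cases hpK : ∃ l, p l ∉ K
  · exact Or.inl hpK
  refine Or.inr ?_
  push Not at hpK
  have : ∃ a ∈ emptyPolygonAreas (Set.range p), A < a := by
    by_contra hcon
    push Not at hcon
    -- Nonnegativity of A covers the case of no empty polygon, where the supremum is 0.
    exact hp (Real.sSup_le hcon hA.le)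
  obtain ⟨_, ⟨V, ⟨hVp, hV3, -⟩, hempty, rfl⟩, hAV⟩ := this
  have hVne : V.Nonempty := Finset.card_pos.1 (by omega)
  obtain ⟨_, hP, _, hQ, hlt, k, hk⟩ := exists_gridKite_subset V hVne hA hAV.le hN
  obtain ⟨i, rfl⟩ := hVp hP
  obtain ⟨j, rfl⟩ := hVp hQ
  have hij : i ≠ j := by rintro rfl; exact lt_irrefl _ hlt
  have hVK : convexHull ℝ (V : Set Plane) ⊆ K := convexHull_min
    (hVp.trans (Set.range_subset_iff.2 hpK)) hK
  have hopen : IsOpen (Prod.mk (p i, p j) ⁻¹' gridKite N A k) := isOpen_kite_section _ _ _ _ _ _ _ _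
  simp only [Set.mem_iUnion]
  refine ⟨i, j, hij, k, ?_, fun l _ _ hl => ?_⟩
  · rw [Measure.restrict_apply hopen.measurableSet, Set.inter_eq_left.2 (hk.trans hVK),
      volume_gridKite_section hA.le k hlt]
  · exact Set.disjoint_left.1 hempty (interior_maximal hk hopen hl) ⟨l, rfl⟩

theorem pi_polyMax_gt_le {K : Set Plane} (hK : Convex ℝ K) (hKarea : volume K = 1) {A : ℝ}
    (hA : 0 < A) {N : ℕ} (hN : 0 < N) (n : ℕ) :
    Measure.pi (fun _ : Fin n => (volume : Measure Plane).restrict K)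
        {p : Fin n → Plane | polyMax (Set.range p) ≤ A}ᶜ ≤
      (n : ℝ≥0∞) * (n * ((N * (N * N) : ℕ) *
        (1 - ENNReal.ofReal (A / 2 * ((N - 1) / (N + 1)))) ^ (n - 2))) := by
  have : IsProbabilityMeasure ((volume : Measure Plane).restrict K) := ⟨by simpa using hKarea⟩
  refine (measure_mono (polyMax_gt_subset hK hA hN n)).trans ((measure_union_le _ _).trans ?_)
  rw [pi_restrict_exists_notMem hK hKarea, zero_add]
  have hconst : ∀ (ι : Type) [Fintype ι] (c : ℝ≥0∞), ∑ _i : ι, c = Fintype.card ι * c := by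
    intro ι _ c; simp
  refine (measure_iUnion_fintype_le _ _).trans ?_
  refine (Finset.sum_le_sum fun i _ => (measure_iUnion_fintype_le _ _).trans
    (Finset.sum_le_sum fun j _ => ?_)).trans (b := ∑ _i : Fin n, ∑ _j : Fin n,
      ∑ _k : Fin N × Fin N × Fin N,
        (1 - ENNReal.ofReal (A / 2 * ((N - 1) / (N + 1)))) ^ (n - 2)) ?_
  · by_cases hij : i = j
    · simp [hij]
    · simp only [ne_eq, hij, not_false_eq_true, Set.iUnion_true]
      refine (measure_iUnion_fintype_le _ _).trans (Finset.sum_le_sum fun k _ => ?_)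
      exact pi_pair_region_empty_le _ _ (measurableSet_kite _ _ _ _ _ _) i j hij _
  · rw [hconst, hconst, hconst]
    simp

/-- The source of the constant 4: the n² pairs must be beaten by n^(-c), and c is just below half
the coefficient of the area. -/
theorem tendsto_sq_mul_exp_neg {c : ℝ} (hc : 2 < c) :
    Tendsto (fun n : ℕ => (n : ℝ) ^ 2 * Real.exp (-(c * (Real.log n / n)) * (n - 2))) atTop
      (𝓝 0) := by
  have hlog : Tendsto (fun n : ℕ => Real.log n) atTop atTop :=
    Real.tendsto_log_atTop.comp tendsto_natCast_atTop_atTop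
  have hinv : Tendsto (fun n : ℕ => (2 : ℝ) - c * (1 - 2 / n)) atTop (𝓝 (2 - c * (1 - 0))) :=
    ((tendsto_const_div_atTop_nhds_zero_nat 2).const_sub 1 |>.const_mul c).const_sub 2
  have h := Real.tendsto_exp_atBot.comp (hinv.neg_mul_atTop (by linarith) hlog)
  refine h.congr' ?_
  filter_upwards [eventually_gt_atTop 0] with n hn
  have hn' : (0 : ℝ) < n := Nat.cast_pos.2 hn
  have e : (n : ℝ) ^ 2 = Real.exp (2 * Real.log n) := by
    rw [mul_comm, Real.exp_mul, Real.exp_log hn']; norm_cast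
  simp only [Function.comp]
  rw [e, ← Real.exp_add]
  congr 1
  field_simp
  ring

theorem tendsto_uniformSample_polyMax_gt {K : Set Plane} (hK : Convex ℝ K) (hKarea : volume K = 1)
    {ε : ℝ} (hε : 0 < ε) :
    Tendsto (fun n : ℕ => uniformSample K n
      {p | polyMax (Set.range p) ≤ (4 + ε) * (Real.log n / n)}ᶜ) atTop (𝓝 0) := by
  -- N is so large that the factor (N - 1)/(N + 1) leaves half of 4 + ε above 2.
  obtain ⟨N, hN⟩ := exists_nat_gt (2 * (4 + ε) / ε)
  have hN0 : (0 : ℝ) < N := lt_trans (by positivity) hN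
  have hNpos : 0 < N := by exact_mod_cast hN0
  set c : ℝ := (4 + ε) / 2 * ((N - 1) / (N + 1)) with hc_def
  have hc : 2 < c := by
    rw [div_lt_iff₀ hε] at hN
    rw [hc_def, div_mul_div_comm, lt_div_iff₀ (by positivity)]
    nlinarith
  have hlim := (tendsto_sq_mul_exp_neg hc).const_mul (((N * (N * N) : ℕ) : ℝ))
  rw [mul_zero] at hlim
  have hlim' := ENNReal.tendsto_ofReal hlim
  rw [ENNReal.ofReal_zero] at hlim'
  refine tendsto_of_tendsto_of_tendsto_of_le_of_le' tendsto_const_nhds hlim'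
    (Eventually.of_forall fun _ => zero_le) ?_
  filter_upwards [eventually_ge_atTop 2] with n hn
  have hn' : (2 : ℝ) ≤ n := by exact_mod_cast hn
  have hL : 0 < Real.log n / n := div_pos (Real.log_pos (by linarith)) (by linarith)
  rw [uniformSample, cond_volume_eq_restrict hKarea]
  refine (pi_polyMax_gt_le hK hKarea (A := (4 + ε) * (Real.log n / n)) (by positivity) hNpos
    n).trans ?_
  have ea : (4 + ε) * (Real.log n / n) / 2 * ((N - 1) / (N + 1)) = c * (Real.log n / n) := by
    rw [hc_def]; ring
  rw [ea]
  have h1 : (1 - ENNReal.ofReal (c * (Real.log n / n))) ^ (n - 2) ≤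
      ENNReal.ofReal (Real.exp (-(c * (Real.log n / n)) * (n - 2))) := by
    have : 1 - ENNReal.ofReal (c * (Real.log n / n)) ≤
        ENNReal.ofReal (Real.exp (-(c * (Real.log n / n)))) := by
      rw [← ENNReal.ofReal_one, ← ENNReal.ofReal_sub _ (by positivity)]
      exact ENNReal.ofReal_le_ofReal (Real.one_sub_le_exp_neg _)
    refine (pow_le_pow_left₀ zero_le this _).trans ?_
    rw [← ENNReal.ofReal_pow (Real.exp_pos _).le, ← Real.exp_nat_mul, Nat.cast_sub hn]
    apply le_of_eq; congr 2; push_cast; ring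
  calc (n : ℝ≥0∞) * (n * ((N * (N * N) : ℕ) * (1 - ENNReal.ofReal (c * (Real.log n / n))) ^ (n - 2)))
      ≤ (n : ℝ≥0∞) * (n * ((N * (N * N) : ℕ) *
          ENNReal.ofReal (Real.exp (-(c * (Real.log n / n)) * (n - 2))))) := by gcongr
    _ = _ := by
      rw [← ENNReal.ofReal_natCast, ← ENNReal.ofReal_natCast, ← ENNReal.ofReal_mul (by positivity),
        ← ENNReal.ofReal_mul (by positivity), ← ENNReal.ofReal_mul (by positivity)]
      congr 1; ring

/-! ### Second moment method for point patterns in disjoint cells -/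

theorem prod_mem_range_ite {κ : Type*} [Fintype κ] {n : ℕ} (σ : κ ↪ Fin n) (x y : ℝ)
    [DecidablePred (· ∈ Set.range σ)] :
    ∏ l, (if l ∈ Set.range σ then x else y) =
      x ^ Fintype.card κ * y ^ (n - Fintype.card κ) := by
  classical
  have h : (Finset.univ.filter (· ∈ Set.range σ)).card = Fintype.card κ := by
    rw [show Finset.univ.filter (· ∈ Set.range σ) = Finset.univ.map σ by ext; simp]
    simp
  have h' := Finset.card_filter_add_card_filter_not (s := (Finset.univ : Finset (Fin n)))
    (p := (· ∈ Set.range σ))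
  rw [Finset.prod_ite, Finset.prod_const, Finset.prod_const, h]
  rw [h, Finset.card_univ, Fintype.card_fin] at h'
  congr 2
  omega

/-- The constraint on the point with index `l` in the event that the points with indices `σ k` lie
in the sets `B k` and all other points avoid `C`. -/
def patternSet {X κ : Type*} {n : ℕ} (C : Set X) (B : κ → Set X) (σ : κ ↪ Fin n) (l : Fin n) :
    Set X :=
  {z | (∀ k, σ k = l → z ∈ B k) ∧ ((∀ k, σ k ≠ l) → z ∉ C)}

theorem patternSet_apply {X κ : Type*} {n : ℕ} (C : Set X) (B : κ → Set X) (σ : κ ↪ Fin n)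
    (k : κ) : patternSet C B σ (σ k) = B k := by
  ext z
  simp only [patternSet, Set.mem_ofPred_eq]
  constructor
  · exact fun h => h.1 k rfl
  · exact fun h => ⟨fun k' hk' => σ.injective hk' ▸ h, fun h' => absurd rfl (h' k)⟩

theorem patternSet_of_notMem_range {X κ : Type*} {n : ℕ} (C : Set X) (B : κ → Set X)
    (σ : κ ↪ Fin n) {l : Fin n} (hl : l ∉ Set.range σ) : patternSet C B σ l = Cᶜ := by
  have h : ∀ k, σ k ≠ l := fun k hk => hl ⟨k, hk⟩
  ext z
  simp [patternSet, h]

theorem measureReal_pi_pi {X : Type*} [MeasurableSpace X] (μ : Measure X) [IsProbabilityMeasure μ]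
    {n : ℕ} (S : Fin n → Set X) :
    (Measure.pi fun _ : Fin n => μ).real (Set.univ.pi S) = ∏ l, μ.real (S l) := by
  simp [Measure.real, Measure.pi_pi, ENNReal.toReal_prod]

/-- Among many disjoint cells of equal measure there is, with high probability, one whose only
sample points are exactly one point in each of its marked subsets. -/
theorem pi_no_pattern_le {X κ : Type*} [MeasurableSpace X] [Fintype κ]
    (μ : Measure X) [IsProbabilityMeasure μ] {M n : ℕ} (hM : 0 < M) (hn : Fintype.card κ ≤ n)
    (C : Fin M → Set X) (B : Fin M → κ → Set X) (hC : ∀ i, MeasurableSet (C i))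
    (hB : ∀ i k, MeasurableSet (B i k)) (hBC : ∀ i k, B i k ⊆ C i)
    (hCd : ∀ i j, i ≠ j → Disjoint (C i) (C j))
    (hBd : ∀ i k k', k ≠ k' → Disjoint (B i k) (B i k')) {a b : ℝ}
    (hCa : ∀ i, μ.real (C i) = a) (hBb : ∀ i k, μ.real (B i k) = b) (ha : a < 1) (hb : 0 < b) :
    (Measure.pi fun _ : Fin n => μ).real
        (⋃ e : Fin M × (κ ↪ Fin n), Set.univ.pi (patternSet (C e.1) (B e.1) e.2))ᶜ ≤
      1 / ((M * n.descFactorial (Fintype.card κ) : ℕ) *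
        (b ^ Fintype.card κ * (1 - a) ^ (n - Fintype.card κ))) +
      ((1 - a)⁻¹ ^ Fintype.card κ * (1 - a)⁻¹ ^ Fintype.card κ - 1) := by
  classical
  have ha' : 0 < 1 - a := by linarith
  have hcompl : ∀ i, μ.real (C i)ᶜ = 1 - a := fun i => by
    rw [probReal_compl_eq_one_sub (hC i), hCa]
  have hS : ∀ (e : Fin M × (κ ↪ Fin n)) l, μ.real (patternSet (C e.1) (B e.1) e.2 l) =
      if l ∈ Set.range e.2 then b else 1 - a := by
    intro e l
    split_ifs with h
    · obtain ⟨k, rfl⟩ := h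
      rw [patternSet_apply, hBb]
    · rw [patternSet_of_notMem_range _ _ _ h, hcompl]
  have hSm : ∀ (e : Fin M × (κ ↪ Fin n)) l, MeasurableSet (patternSet (C e.1) (B e.1) e.2 l) := by
    intro e l
    by_cases h : l ∈ Set.range e.2
    · obtain ⟨k, rfl⟩ := h
      rw [patternSet_apply]; exact hB _ _
    · rw [patternSet_of_notMem_range _ _ _ h]; exact (hC _).compl
  have hcard : Fintype.card (Fin M × (κ ↪ Fin n)) = M * n.descFactorial (Fintype.card κ) := by
    rw [Fintype.card_prod, Fintype.card_fin, Fintype.card_embedding_eq, Fintype.card_fin]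
  have hprob : ∀ e : Fin M × (κ ↪ Fin n), (Measure.pi fun _ : Fin n => μ).real
      (Set.univ.pi (patternSet (C e.1) (B e.1) e.2)) =
        b ^ Fintype.card κ * (1 - a) ^ (n - Fintype.card κ) := by
    intro e
    rw [measureReal_pi_pi, ← prod_mem_range_ite e.2]
    exact Finset.prod_congr rfl fun l _ => hS e l
  rw [← hcard]
  refine measureReal_compl_iUnion_le _ _
    (fun e => MeasurableSet.univ_pi (hSm e)) _ _ (by positivity)
    (by rw [hcard]; exact Nat.mul_pos hM (Nat.descFactorial_pos.2 hn)) (by positivity) hprob ?_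
  rintro ⟨i, σ⟩ ⟨j, τ⟩ hne
  rw [← Set.pi_inter_distrib, measureReal_pi_pi, sq]
  nth_rewrite 1 [← hprob (i, σ)]
  rw [← hprob (j, τ), measureReal_pi_pi, measureReal_pi_pi]
  -- The correlation factor is spread over the indices, one (1 - a)⁻¹ for each index used by σ and
  -- one for each used by τ, so that the products can be compared factor by factor.
  have hu : ∀ σ : κ ↪ Fin n, (1 - a)⁻¹ ^ Fintype.card κ =
      ∏ l, if l ∈ Set.range σ then (1 - a)⁻¹ else 1 := fun σ => by
    rw [prod_mem_range_ite, one_pow, mul_one]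
  nth_rewrite 1 [hu σ]
  rw [hu τ, ← Finset.prod_mul_distrib, ← Finset.prod_mul_distrib, ← Finset.prod_mul_distrib]
  have hnn : ∀ l, 0 ≤ (if l ∈ Set.range σ then (1 - a)⁻¹ else 1) *
      (if l ∈ Set.range τ then (1 - a)⁻¹ else 1) *
      (μ.real (patternSet (C i) (B i) σ l) * μ.real (patternSet (C j) (B j) τ l)) := fun l => by
    have : 0 ≤ (1 - a)⁻¹ := by positivity
    refine mul_nonneg (mul_nonneg ?_ ?_) (by positivity) <;> split_ifs <;> positivity
  -- Two different patterns in one cell exclude each other: a point with index σ k ≠ τ k would have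
  -- to lie in `B i k` and also in another marked subset or outside the cell.
  by_cases hij : i = j
  · subst hij
    have hστ : ∃ k, σ k ≠ τ k := by
      by_contra hcon
      push Not at hcon
      exact hne (by rw [DFunLike.ext σ τ hcon])
    obtain ⟨k, hk⟩ := hστ
    have hdisj : patternSet (C i) (B i) σ (σ k) ∩ patternSet (C i) (B i) τ (σ k) = ∅ := by
      rw [patternSet_apply, ← Set.disjoint_iff_inter_eq_empty]
      by_cases h : σ k ∈ Set.range τ
      · obtain ⟨k', hk'⟩ := h
        rw [← hk', patternSet_apply]
        exact hBd i k k' (by rintro rfl; exact hk hk'.symm)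
      · rw [patternSet_of_notMem_range _ _ _ h]
        exact Set.disjoint_compl_right_iff_subset.2 (hBC i k)
    rw [Finset.prod_eq_zero (Finset.mem_univ (σ k)) (by rw [hdisj]; simp)]
    exact Finset.prod_nonneg fun l _ => hnn l
  · refine Finset.prod_le_prod (fun l _ => measureReal_nonneg) fun l _ => ?_
    by_cases h1 : l ∈ Set.range σ <;> by_cases h2 : l ∈ Set.range τ
    · refine le_trans (le_of_eq ?_) (hnn l)
      obtain ⟨k, rfl⟩ := h1
      obtain ⟨k', hk'⟩ := h2
      rw [patternSet_apply, ← hk', patternSet_apply]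
      rw [Set.disjoint_iff_inter_eq_empty.1 ((hCd i j hij).mono (hBC i k) (hBC j k'))]
      simp
    · rw [hS (i, σ), hS (j, τ)]
      simp only [h1, h2, if_true, if_false]
      refine (measureReal_mono Set.inter_subset_left).trans (le_of_eq ?_)
      rw [hS (i, σ)]
      simp only [h1, if_true]
      field_simp
    · rw [hS (i, σ), hS (j, τ)]
      simp only [h1, h2, if_true, if_false]
      refine (measureReal_mono Set.inter_subset_right).trans (le_of_eq ?_)
      rw [hS (j, τ)]
      simp only [h2, if_true]
      field_simp
    · rw [hS (i, σ), hS (j, τ), patternSet_of_notMem_range _ _ _ h1,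
        patternSet_of_notMem_range _ _ _ h2, ← Set.compl_union,
        probReal_compl_eq_one_sub ((hC i).union (hC j)),
        measureReal_union (hCd i j hij) (hC j), hCa, hCa]
      simp only [h1, h2, if_false]
      -- An unmarked index avoids both disjoint cells: 1 - 2a ≤ (1 - a)².
      nlinarith [sq_nonneg a]

/-! ### Quadrilaterals with vertices near the corners of a rectangle -/

/-- The initial (for `false`) or final (for `true`) part of relative length `η` of the interval
`[x, x + d)`. -/
def endInterval (x d η : ℝ) (b : Bool) : Set ℝ :=
  if b then Set.Ico (x + (1 - η) * d) (x + d) else Set.Ico x (x + η * d)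

/-- The half-open rectangle with lower left corner `(x, y)` and side lengths `d` and `ℓ`. -/
def box (x y d ℓ : ℝ) : Set Plane :=
  {z | z 0 ∈ Set.Ico x (x + d) ∧ z 1 ∈ Set.Ico y (y + ℓ)}

/-- The copy scaled by `η` of the rectangle `box x y d ℓ` in its corner `k`. -/
def cornerBox (x y d ℓ η : ℝ) (k : Bool × Bool) : Set Plane :=
  {z | z 0 ∈ endInterval x d η k.1 ∧ z 1 ∈ endInterval y ℓ η k.2}

/-- The sign `1` for `true` and `-1` for `false`. -/
def boolSign (b : Bool) : ℝ := if b then 1 else -1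

/-- The linear functional that is largest in the corner `k` of a rectangle with side lengths `d`
and `ℓ`. -/
noncomputable def cornerFunctional (d ℓ : ℝ) (k : Bool × Bool) (z : Plane) : ℝ :=
  boolSign k.1 * (z 0 / d) + boolSign k.2 * (z 1 / ℓ)

theorem isLinearMap_cornerFunctional (d ℓ : ℝ) (k : Bool × Bool) :
    IsLinearMap ℝ (cornerFunctional d ℓ k) := by
  constructor
  · intro z w; simp only [cornerFunctional, PiLp.add_apply]; ring
  · intro c z; simp only [cornerFunctional, PiLp.smul_apply, smul_eq_mul]; ring

theorem convex_box (x y d ℓ : ℝ) : Convex ℝ (box x y d ℓ) :=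
  ((convex_Ico x (x + d)).is_linear_preimage (f := fun z : Plane => z 0)
    ⟨fun _ _ => rfl, fun _ _ => rfl⟩).inter
  ((convex_Ico y (y + ℓ)).is_linear_preimage (f := fun z : Plane => z 1)
    ⟨fun _ _ => rfl, fun _ _ => rfl⟩)

theorem endInterval_subset {x d η : ℝ} (hd : 0 < d) (h1 : η < 1 / 4) (b : Bool) :
    endInterval x d η b ⊆ Set.Ico x (x + d) := by
  cases b
  · simp only [endInterval]; exact Set.Ico_subset_Ico_right (by nlinarith)
  · simp only [endInterval]; exact Set.Ico_subset_Ico_left (by nlinarith)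

theorem cornerBox_subset {x y d ℓ η : ℝ} (hd : 0 < d) (hℓ : 0 < ℓ) (h1 : η < 1 / 4)
    (k : Bool × Bool) : cornerBox x y d ℓ η k ⊆ box x y d ℓ :=
  fun _ hz => ⟨endInterval_subset hd h1 _ hz.1, endInterval_subset hℓ h1 _ hz.2⟩

theorem boolSign_mul_lt {x d η s s' : ℝ} (hd : 0 < d) {b b' : Bool}
    (hs : s ∈ endInterval x d η b) (hs' : s' ∈ endInterval x d η b') :
    boolSign b * (s' / d) < boolSign b * (s / d) + if b = b' then η else 2 * η - 1 := by
  have key : ∀ c : ℝ, boolSign b * s' < boolSign b * s + c * d →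
      boolSign b * (s' / d) < boolSign b * (s / d) + c := by
    intro c h
    rw [← mul_div_assoc, ← mul_div_assoc, div_add' _ _ _ hd.ne']
    exact div_lt_div_of_pos_right h hd
  apply key
  cases b <;> cases b' <;> simp [endInterval, boolSign] at * <;> nlinarith

/-- A coordinate on the same side gains less than η and one on the opposite side loses more than 1 -
2η. With at least one opposite coordinate the net change is negative, as 3η < 1. -/
theorem cornerFunctional_lt {x y d ℓ η : ℝ} (hd : 0 < d) (hℓ : 0 < ℓ) (h0 : 0 < η)
    (h1 : η < 1 / 4) {k k' : Bool × Bool} (hk : k ≠ k') {z z' : Plane}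
    (hz : z ∈ cornerBox x y d ℓ η k) (hz' : z' ∈ cornerBox x y d ℓ η k') :
    cornerFunctional d ℓ k z' < cornerFunctional d ℓ k z := by
  have e1 := boolSign_mul_lt hd hz.1 hz'.1
  have e2 := boolSign_mul_lt hℓ hz.2 hz'.2
  simp only [cornerFunctional]
  by_cases hb1 : k.1 = k'.1 <;> by_cases hb2 : k.2 = k'.2
  · exact absurd (Prod.ext hb1 hb2) hk
  all_goals
    simp only [hb1, hb2, if_true, if_false] at e1 e2 ⊢
    linarith

theorem disjoint_cornerBox {x y d ℓ η : ℝ} (hd : 0 < d) (hℓ : 0 < ℓ) (h0 : 0 < η)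
    (h1 : η < 1 / 4) {k k' : Bool × Bool} (hk : k ≠ k') :
    Disjoint (cornerBox x y d ℓ η k) (cornerBox x y d ℓ η k') :=
  Set.disjoint_left.2 fun _ hz hz' => lt_irrefl _ (cornerFunctional_lt hd hℓ h0 h1 hk hz hz')

/-- A functional separating z from the hull is defeated by the vertex in the corner selected by the
signs of its two coefficients. -/
theorem inner_box_subset_convexHull {x y d ℓ η : ℝ} {v : Bool × Bool → Plane}
    (hv : ∀ k, v k ∈ cornerBox x y d ℓ η k) :
    {z : Plane | z 0 ∈ Set.Ico (x + η * d) (x + (1 - η) * d) ∧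
      z 1 ∈ Set.Ico (y + η * ℓ) (y + (1 - η) * ℓ)} ⊆ convexHull ℝ (Set.range v) := by
  rintro z ⟨hz0, hz1⟩
  by_contra hz
  obtain ⟨f, u, hf, hu⟩ := geometric_hahn_banach_closed_point (convex_convexHull ℝ (Set.range v))
    ((Set.finite_range v).isClosed_convexHull ℝ) hz
  have hrep : ∀ w : Plane, f w = w 0 * f (EuclideanSpace.single 0 1) +
      w 1 * f (EuclideanSpace.single 1 1) := by
    intro w
    have : w = w 0 • EuclideanSpace.single (0 : Fin 2) (1 : ℝ) +
        w 1 • EuclideanSpace.single (1 : Fin 2) (1 : ℝ) := by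
      ext i; fin_cases i <;> simp
    conv_lhs => rw [this]
    rw [map_add, map_smul, map_smul, smul_eq_mul, smul_eq_mul]
  have hlt : ∀ k, f (v k) < f z := fun k =>
    (hf _ (subset_convexHull ℝ _ ⟨k, rfl⟩)).trans hu
  have coord : ∀ {x d s c : ℝ}, s ∈ Set.Ico (x + η * d) (x + (1 - η) * d) →
      ∃ b, ∀ s' ∈ endInterval x d η b, s * c ≤ s' * c := by
    intro x d s c hs
    rcases le_total 0 c with h | h
    · refine ⟨true, fun s' hs' => mul_le_mul_of_nonneg_right ?_ h⟩
      simp only [endInterval, if_true] at hs'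
      linarith [hs.2, hs'.1]
    · refine ⟨false, fun s' hs' => mul_le_mul_of_nonpos_right ?_ h⟩
      simp only [endInterval] at hs'
      linarith [hs.1, hs'.2]
  obtain ⟨b₁, h₁⟩ := coord (c := f (EuclideanSpace.single 0 1)) hz0
  obtain ⟨b₂, h₂⟩ := coord (c := f (EuclideanSpace.single 1 1)) hz1
  have := hlt (b₁, b₂)
  rw [hrep, hrep z] at this
  linarith [h₁ _ (hv (b₁, b₂)).1, h₂ _ (hv (b₁, b₂)).2]

/-- Each vertex is the strict maximizer of its corner functional among the four, which gives convex
position. The only points of P in the rectangle are these vertices, and a maximizer of a nonzero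
functional is not interior. -/
theorem le_polyMax_of_corner_points {x y d ℓ η : ℝ} (hd : 0 < d) (hℓ : 0 < ℓ) (h0 : 0 < η)
    (h1 : η < 1 / 4) {P : Set Plane} (hP : P.Finite) {v : Bool × Bool → Plane}
    (hv : ∀ k, v k ∈ cornerBox x y d ℓ η k) (hvP : Set.range v ⊆ P)
    (hPv : P ∩ box x y d ℓ ⊆ Set.range v) :
    (1 - 2 * η) ^ 2 * (d * ℓ) ≤ polyMax P := by
  classical
  have hvlt : ∀ k k', k ≠ k' → cornerFunctional d ℓ k (v k') < cornerFunctional d ℓ k (v k) :=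
    fun k k' hk => cornerFunctional_lt hd hℓ h0 h1 hk (hv k) (hv k')
  have hinj : Function.Injective v := fun k k' h => by
    by_contra hk
    exact absurd (hvlt k k' hk) (by rw [h]; exact lt_irrefl _)
  set V : Finset Plane := Finset.univ.image v with hV
  have hVr : (V : Set Plane) = Set.range v := by simp [hV]
  have hpoly : IsConvexPolygonIn P V := by
    refine ⟨hVr ▸ hvP, ?_, ?_⟩
    · rw [hV, Finset.card_image_of_injective _ hinj]; decide
    · refine convexIndependent_set_iff_notMem_convexHull_sdiff.2 fun z hz hmem => ?_
      rw [hVr] at hz hmem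
      obtain ⟨k, rfl⟩ := hz
      have hsub : convexHull ℝ (Set.range v \ {v k}) ⊆
          {z | cornerFunctional d ℓ k z < cornerFunctional d ℓ k (v k)} := by
        refine convexHull_min ?_ (convex_halfSpace_lt (isLinearMap_cornerFunctional d ℓ k) _)
        rintro _ ⟨⟨k', rfl⟩, hk'⟩
        exact hvlt k k' (by rintro rfl; exact hk' rfl)
      exact lt_irrefl (cornerFunctional d ℓ k (v k)) (hsub hmem)
  have hbox : convexHull ℝ (Set.range v) ⊆ box x y d ℓ := by
    refine convexHull_min ?_ (convex_box _ _ _ _)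
    rintro _ ⟨k, rfl⟩
    exact cornerBox_subset hd hℓ h1 k (hv k)
  have hhole : IsHole P (convexHull ℝ (V : Set Plane)) := by
    rw [hVr]
    refine Set.disjoint_left.2 fun z hz hzP => ?_
    obtain ⟨k, rfl⟩ := hPv ⟨hzP, hbox (interior_subset hz)⟩
    have hsub : convexHull ℝ (Set.range v) ⊆
        {z | cornerFunctional d ℓ k z ≤ cornerFunctional d ℓ k (v k)} := by
      refine convexHull_min ?_ (convex_halfSpace_le (isLinearMap_cornerFunctional d ℓ k) _)
      rintro _ ⟨k', rfl⟩
      by_cases hk : k = k'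
      · subst hk; exact le_refl (cornerFunctional d ℓ k (v k))
      · exact (hvlt k k' hk).le
    -- Moving from the vertex in this direction increases its functional, so an interior vertex
    -- could not be a maximizer.
    let e : Plane := !₂[boolSign k.1, boolSign k.2]
    have hcont : Continuous fun t : ℝ => v k + t • e := by fun_prop
    have hev : ∀ᶠ t in 𝓝 (0 : ℝ), v k + t • e ∈ interior (convexHull ℝ (Set.range v)) :=
      hcont.continuousAt.eventually_mem (isOpen_interior.mem_nhds (by simpa using hz))
    obtain ⟨t, ht, ht0⟩ := ((hev.filter_mono nhdsWithin_le_nhds).and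
      (self_mem_nhdsWithin (a := (0 : ℝ)) (s := Set.Ioi 0))).exists
    have hle := hsub (interior_subset ht)
    have hsq : ∀ b, boolSign b * boolSign b = 1 := fun b => by cases b <;> simp [boolSign]
    have heq : cornerFunctional d ℓ k (v k + t • e) =
        cornerFunctional d ℓ k (v k) + t * (1 / d + 1 / ℓ) := by
      simp only [cornerFunctional, PiLp.add_apply, PiLp.smul_apply, smul_eq_mul, e,
        Matrix.cons_val_zero, Matrix.cons_val_one]
      linear_combination t / d * hsq k.1 + t / ℓ * hsq k.2
    simp only [Set.mem_ofPred_eq, heq] at hle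
    have : 0 < t * (1 / d + 1 / ℓ) := mul_pos ht0 (by positivity)
    linarith
  have harea : (1 - 2 * η) ^ 2 * (d * ℓ) ≤ volume.real (convexHull ℝ (V : Set Plane)) := by
    rw [hVr]
    have hfin : volume (convexHull ℝ (Set.range v)) ≠ ∞ :=
      ((Set.finite_range v).isCompact_convexHull ℝ).measure_lt_top.ne
    refine le_trans (le_of_eq ?_)
      (ENNReal.toReal_mono hfin (measure_mono (inner_box_subset_convexHull hv)))
    rw [volume_box, ENNReal.toReal_mul, ENNReal.toReal_ofReal (by nlinarith),
      ENNReal.toReal_ofReal (by nlinarith)]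
    ring
  exact harea.trans (le_csSup (emptyPolygonAreas_finite hP).bddAbove ⟨V, hpoly, hhole, rfl⟩)

/-! ### Lower bound: strips of a square inside K -/

theorem measurableSet_box (x y d ℓ : ℝ) : MeasurableSet (box x y d ℓ) := by
  have hc : ∀ i : Fin 2, Measurable fun z : Plane => z i := fun i => by fun_prop
  exact ((hc 0) measurableSet_Ico).inter ((hc 1) measurableSet_Ico)

theorem cornerBox_eq_box (x y d ℓ η : ℝ) (k : Bool × Bool) :
    cornerBox x y d ℓ η k = box (if k.1 then x + (1 - η) * d else x)
      (if k.2 then y + (1 - η) * ℓ else y) (η * d) (η * ℓ) := by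
  have h : ∀ x d b, endInterval x d η b =
      Set.Ico (if b then x + (1 - η) * d else x) ((if b then x + (1 - η) * d else x) + η * d) := by
    intro x d b
    cases b
    · simp [endInterval]
    · simp only [endInterval, if_true]; congr 1; ring
  simp only [cornerBox, box, h]

theorem volume_real_box (x y : ℝ) {d ℓ : ℝ} (hd : 0 ≤ d) (hℓ : 0 ≤ ℓ) :
    volume.real (box x y d ℓ) = d * ℓ := by
  rw [Measure.real, box, volume_box, ENNReal.toReal_mul, add_sub_cancel_left, add_sub_cancel_left,
    ENNReal.toReal_ofReal hd, ENNReal.toReal_ofReal hℓ]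

theorem exists_box_subset {K : Set Plane} (hK : Convex ℝ K) (hKarea : volume K = 1) :
    ∃ x y ℓ : ℝ, 0 < ℓ ∧ box x y ℓ ℓ ⊆ K := by
  have hne : (interior K).Nonempty := by
    by_contra hcon
    rw [Set.not_nonempty_iff_eq_empty] at hcon
    have h1 : K ⊆ frontier K := by
      rw [frontier, hcon, Set.sdiff_empty]; exact subset_closure
    have := measure_mono_null h1 (hK.addHaar_frontier volume)
    rw [this] at hKarea
    exact zero_ne_one hKarea
  obtain ⟨c, hc⟩ := hne
  obtain ⟨r, hr, hball⟩ := Metric.isOpen_iff.1 isOpen_interior c hc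
  -- A square of side r/2 with a corner at the centre has diagonal r/√2 < r.
  refine ⟨c 0, c 1, r / 2, by positivity, fun z hz => interior_subset (hball ?_)⟩
  rw [Metric.mem_ball, EuclideanSpace.dist_eq, Real.sqrt_lt' hr, Fin.sum_univ_two,
    Real.dist_eq, Real.dist_eq, sq_abs, sq_abs]
  obtain ⟨⟨h1, h2⟩, h3, h4⟩ := hz
  nlinarith

/-- If `K` contains a square of side `ℓ`, then the sample contains a large empty quadrilateral in
one of `M` strips of that square, with an explicit bound on the exceptional probability. -/
theorem pi_polyMax_lt_le {K : Set Plane} (hKarea : volume K = 1) {x y ℓ : ℝ}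
    (hℓ : 0 < ℓ) (hbox : box x y ℓ ℓ ⊆ K) {η a : ℝ} (h0 : 0 < η) (h1 : η < 1 / 4) (ha : 0 < a)
    (ha1 : a < 1) {M n : ℕ} (hM : 0 < M) (hMa : M * a ≤ ℓ ^ 2) (hn : 4 ≤ n) :
    Measure.pi (fun _ : Fin n => (volume : Measure Plane).restrict K)
        {p : Fin n → Plane | (1 - 2 * η) ^ 2 * a ≤ polyMax (Set.range p)}ᶜ ≤
      ENNReal.ofReal (1 / ((M * n.descFactorial 4 : ℕ) * ((η ^ 2 * a) ^ 4 * (1 - a) ^ (n - 4))) +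
        ((1 - a)⁻¹ ^ 4 * (1 - a)⁻¹ ^ 4 - 1)) := by
  have : IsProbabilityMeasure ((volume : Measure Plane).restrict K) := ⟨by simpa using hKarea⟩
  -- The width that gives a strip of height ℓ the area a; `hMa` says that M such strips fit side by
  -- side.
  set d := a / ℓ with hd_def
  have hd : 0 < d := by positivity
  have hdℓ : d * ℓ = a := by rw [hd_def]; field_simp
  have hMd : M * d ≤ ℓ := by
    rw [hd_def, ← mul_div_assoc, div_le_iff₀ hℓ]; nlinarith
  let C : Fin M → Set Plane := fun i => box (x + i * d) y d ℓ
  let B : Fin M → Bool × Bool → Set Plane := fun i k => cornerBox (x + i * d) y d ℓ η k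
  have hCK : ∀ i, C i ⊆ K := by
    rintro i z ⟨⟨h1, h2⟩, h3⟩
    refine hbox ⟨⟨?_, ?_⟩, h3⟩
    · have : 0 ≤ (i : ℝ) * d := by positivity
      linarith
    · have : ((i : ℕ) : ℝ) + 1 ≤ M := by exact_mod_cast i.2
      nlinarith
  have hBC : ∀ i k, B i k ⊆ C i := fun i k => cornerBox_subset hd hℓ h1 k
  have hBm : ∀ i k, MeasurableSet (B i k) := fun i k => by
    simp only [B]; rw [cornerBox_eq_box]; exact measurableSet_box _ _ _ _
  have hreal : ∀ S : Set Plane, MeasurableSet S → S ⊆ K →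
      ((volume : Measure Plane).restrict K).real S = volume.real S := fun S hS hSK => by
    rw [Measure.real, Measure.restrict_apply hS, Set.inter_eq_left.2 hSK, Measure.real]
  have hCd : ∀ i j, i ≠ j → Disjoint (C i) (C j) := by
    have aux : ∀ i j : Fin M, i < j → Disjoint (C i) (C j) := by
      intro i j hij
      refine Set.disjoint_left.2 fun z hz hz' => ?_
      have h := hz.1.2
      have h' := hz'.1.1
      have : ((i : ℕ) : ℝ) + 1 ≤ (j : ℕ) := by exact_mod_cast hij
      nlinarith
    intro i j hij
    rcases hij.lt_or_gt with h | h
    · exact aux i j h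
    · exact (aux j i h).symm
  have hmain := pi_no_pattern_le ((volume : Measure Plane).restrict K) (n := n) (a := a)
    (b := η ^ 2 * a) hM
    (by simpa using hn) C B (fun i => measurableSet_box _ _ _ _) hBm hBC hCd
    (fun i k k' hk => disjoint_cornerBox hd hℓ h0 h1 hk)
    (fun i => by rw [hreal _ (measurableSet_box _ _ _ _) (hCK i), volume_real_box _ _ hd.le hℓ.le,
      hdℓ])
    (fun i k => by
      rw [hreal _ (hBm i k) ((hBC i k).trans (hCK i))]
      simp only [B]
      rw [cornerBox_eq_box, volume_real_box _ _ (by positivity) (by positivity), ← hdℓ]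
      ring)
    ha1 (by positivity)
  rw [show Fintype.card (Bool × Bool) = 4 by simp] at hmain
  refine le_trans (measure_mono ?_) (ENNReal.le_ofReal_iff_toReal_le (measure_ne_top _ _) ?_ |>.2
    hmain)
  · refine Set.compl_subset_compl.2 (Set.iUnion_subset ?_)
    rintro ⟨i, σ⟩ p hp
    have hcorner : ∀ k, p (σ k) ∈ B i k := fun k => (hp (σ k) trivial).1 k rfl
    have := le_polyMax_of_corner_points hd hℓ h0 h1 (Set.finite_range p) (v := p ∘ σ) hcorner
      (Set.range_comp_subset_range σ p) (by
        rintro _ ⟨⟨l, rfl⟩, hl⟩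
        by_contra hcon
        exact (hp l trivial).2 (fun k hk => hcon ⟨k, by rw [← hk]; rfl⟩) hl)
    rwa [hdℓ] at this
  · exact le_trans measureReal_nonneg hmain

theorem tendsto_log_div_natCast : Tendsto (fun n : ℕ => Real.log n / n) atTop (𝓝 0) :=
  Real.isLittleO_log_id_atTop.tendsto_div_nhds_zero.comp tendsto_natCast_atTop_atTop

theorem exp_neg_le_one_sub_pow {a : ℝ} (ha : 0 ≤ a) (ha1 : a < 1) (n m : ℕ) (hm : m ≤ n) :
    Real.exp (-(n * a / (1 - a))) ≤ (1 - a) ^ m := by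
  have h : 0 < 1 - a := by linarith
  have hlog := Real.one_sub_inv_le_log_of_pos h
  calc Real.exp (-(n * a / (1 - a))) = Real.exp (n * (1 - (1 - a)⁻¹)) := by
        congr 1; field_simp; ring
    _ ≤ Real.exp (n * Real.log (1 - a)) := by gcongr
    _ = (1 - a) ^ n := by rw [mul_comm, Real.exp_mul, Real.exp_log h, Real.rpow_natCast]
    _ ≤ (1 - a) ^ m := pow_le_pow_of_le_one h.le (by linarith) hm

/-- The source of the constant 1: about n/log n strips, n⁴ ordered quadruples, (log n / n)⁴ for the
corners and n^(-c) for emptiness multiply to order n^(1-c) (log n)³. -/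
theorem tendsto_expected_pattern_count {c ℓ η : ℝ} (hc : 0 < c) (hc1 : c < 1) (hℓ : 0 < ℓ)
    (hη : 0 < η) :
    Tendsto (fun n : ℕ => ((⌊ℓ ^ 2 / (c * (Real.log n / n))⌋₊ * n.descFactorial 4 : ℕ) : ℝ) *
      ((η ^ 2 * (c * (Real.log n / n))) ^ 4 * (1 - c * (Real.log n / n)) ^ (n - 4)))
      atTop atTop := by
  have hlog : Tendsto (fun n : ℕ => Real.log n) atTop atTop :=
    Real.tendsto_log_atTop.comp tendsto_natCast_atTop_atTop
  have ha : Tendsto (fun n : ℕ => c * (Real.log n / n)) atTop (𝓝 0) := by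
    simpa using tendsto_log_div_natCast.const_mul c
  have hexponent : Tendsto (fun n : ℕ => 1 - c / (1 - c * (Real.log n / n))) atTop
      (𝓝 (1 - c / (1 - 0))) :=
    (tendsto_const_nhds.div (ha.const_sub 1) (by norm_num)).const_sub 1
  -- The 32 is 2 · 2⁴: a factor 2 lost to the floor and 2⁴ to the falling factorial. The factor (c
  -- log n)³ is only bounded below by c³.
  have hY := (Real.tendsto_exp_atTop.comp (hexponent.pos_mul_atTop (by linarith) hlog)).const_mul_atTop
    (show 0 < ℓ ^ 2 * η ^ 8 / 32 * c ^ 3 by positivity)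
  refine tendsto_atTop_mono' _ ?_ hY
  filter_upwards [ha.eventually_lt_const (show (0 : ℝ) < 1 / 2 by norm_num),
    ha.eventually_le_const (show 0 < ℓ ^ 2 / 2 by positivity), eventually_ge_atTop 6,
    hlog.eventually_ge_atTop 1] with n ha1 ha2 hn hl
  have hn' : (6 : ℝ) ≤ n := by exact_mod_cast hn
  have hn0 : (0 : ℝ) < n := by linarith
  have ha0 : 0 < c * (Real.log n / n) := mul_pos hc (div_pos (by linarith) hn0)
  have hna : n * (c * (Real.log n / n)) = c * Real.log n := by field_simp
  have hpow := exp_neg_le_one_sub_pow ha0.le (by linarith) n (n - 4) (Nat.sub_le _ _)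
  rw [hna] at hpow
  simp only [Function.comp]
  set a := c * (Real.log n / n) with ha_def
  have hM : ℓ ^ 2 / (2 * a) ≤ (⌊ℓ ^ 2 / a⌋₊ : ℝ) := by
    have h1 := (Nat.lt_floor_add_one (ℓ ^ 2 / a)).le
    have h2 : 1 ≤ ℓ ^ 2 / (2 * a) := by rw [le_div_iff₀ (by positivity)]; linarith
    have h3 : ℓ ^ 2 / a = ℓ ^ 2 / (2 * a) + ℓ ^ 2 / (2 * a) := by field_simp; norm_num
    linarith
  have hD : (n / 2 : ℝ) ^ 4 ≤ (n.descFactorial 4 : ℝ) := by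
    have h1 : (((n + 1 - 4) ^ 4 : ℕ) : ℝ) ≤ n.descFactorial 4 := by
      exact_mod_cast Nat.pow_sub_le_descFactorial n 4
    refine le_trans ?_ h1
    rw [Nat.cast_pow, Nat.cast_sub (by omega)]
    push_cast
    gcongr
    linarith
  have hl3 : c ^ 3 ≤ (c * Real.log n) ^ 3 := by
    gcongr; nlinarith
  calc ℓ ^ 2 * η ^ 8 / 32 * c ^ 3 * Real.exp ((1 - c / (1 - a)) * Real.log n)
      ≤ ℓ ^ 2 * η ^ 8 / 32 * (c * Real.log n) ^ 3 *
          Real.exp ((1 - c / (1 - a)) * Real.log n) := by gcongr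
    _ = ℓ ^ 2 * η ^ 8 / 32 * (n * a) ^ 3 * (n * Real.exp (-(c * Real.log n / (1 - a)))) := by
      rw [hna, show (1 - c / (1 - a)) * Real.log n = Real.log n + -(c * Real.log n / (1 - a)) by ring,
        Real.exp_add, Real.exp_log hn0]
    _ = (ℓ ^ 2 / (2 * a) * (n / 2) ^ 4) *
          ((η ^ 2 * a) ^ 4 * Real.exp (-(c * Real.log n / (1 - a)))) := by
      field_simp; norm_num
    _ ≤ _ := by
      push_cast
      gcongr

theorem tendsto_uniformSample_polyMax_lt_of_le_one {K : Set Plane} (hK : Convex ℝ K)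
    (hKarea : volume K = 1) {ε : ℝ} (hε : 0 < ε) (hε1 : ε ≤ 1) :
    Tendsto (fun n : ℕ => uniformSample K n
      {p | (1 - ε) * (Real.log n / n) ≤ polyMax (Set.range p)}ᶜ) atTop (𝓝 0) := by
  obtain ⟨x, y, ℓ, hℓ, hbox⟩ := exists_box_subset hK hKarea
  -- With c = 1 - ε/2 and η = ε/8, (1 - 2η)² c = (1 - ε/4)² (1 - ε/2) ≥ 1 - ε.
  have hcount := tendsto_expected_pattern_count (c := 1 - ε / 2) (η := ε / 8) (by linarith)
    (by linarith) hℓ (by positivity)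
  have ha : Tendsto (fun n : ℕ => (1 - ε / 2) * (Real.log n / n)) atTop (𝓝 0) := by
    simpa using tendsto_log_div_natCast.const_mul (1 - ε / 2)
  have hinv : Tendsto (fun n : ℕ => (1 - (1 - ε / 2) * (Real.log n / n))⁻¹) atTop (𝓝 1) := by
    simpa using (ha.const_sub 1).inv₀ (by norm_num)
  have hlim := (hcount.const_div_atTop 1).add (((hinv.pow 4).mul (hinv.pow 4)).sub_const 1)
  have hlim' := ENNReal.tendsto_ofReal hlim
  norm_num at hlim'
  refine tendsto_of_tendsto_of_tendsto_of_le_of_le' tendsto_const_nhds hlim'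
    (Eventually.of_forall fun _ => zero_le) ?_
  filter_upwards [ha.eventually_lt_const (show (0 : ℝ) < 1 by norm_num),
    ha.eventually_le_const (show 0 < ℓ ^ 2 by positivity), eventually_ge_atTop 4] with n ha1 ha2 hn
  have hn' : (4 : ℝ) ≤ n := by exact_mod_cast hn
  have hL : 0 < Real.log n / n := div_pos (Real.log_pos (by linarith)) (by linarith)
  have ha0 : 0 < (1 - ε / 2) * (Real.log n / n) := mul_pos (by linarith) hL
  rw [uniformSample, cond_volume_eq_restrict hKarea]
  have h := pi_polyMax_lt_le hKarea hℓ hbox (η := ε / 8) (by positivity) (by linarith) ha0 ha1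
    (M := ⌊ℓ ^ 2 / ((1 - ε / 2) * (Real.log n / n))⌋₊) (n := n)
    (Nat.floor_pos.2 ((one_le_div ha0).2 ha2))
    ((le_div_iff₀ ha0).1 (Nat.floor_le (by positivity))) hn
  refine (measure_mono (Set.compl_subset_compl.2 fun p hp => ?_)).trans (h.trans (le_of_eq ?_))
  · rw [Set.mem_ofPred_eq] at hp ⊢
    refine le_trans ?_ hp
    rw [← mul_assoc]
    refine mul_le_mul_of_nonneg_right ?_ hL.le
    nlinarith [mul_nonneg hε.le hε.le, mul_nonneg (mul_nonneg hε.le hε.le) (sub_nonneg.2 hε1)]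
  · norm_num

theorem tendsto_uniformSample_polyMax_lt {K : Set Plane} (hK : Convex ℝ K)
    (hKarea : volume K = 1) {ε : ℝ} (hε : 0 < ε) :
    Tendsto (fun n : ℕ => uniformSample K n
      {p | (1 - ε) * (Real.log n / n) ≤ polyMax (Set.range p)}ᶜ) atTop (𝓝 0) := by
  have h := tendsto_uniformSample_polyMax_lt_of_le_one hK hKarea (ε := min ε 1) (by positivity)
    (min_le_right _ _)
  refine tendsto_of_tendsto_of_tendsto_of_le_of_le tendsto_const_nhds h
    (fun _ => zero_le) fun n => measure_mono (Set.compl_subset_compl.2 fun p hp => ?_)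
  rw [Set.mem_ofPred_eq] at hp ⊢
  refine le_trans (mul_le_mul_of_nonneg_right ?_ ?_) hp
  · linarith [min_le_left ε 1]
  · exact div_nonneg (Real.log_natCast_nonneg n) (Nat.cast_nonneg n)

end ConvexHoles

/-! ### Combination of the two bounds -/

theorem theorem3 (K : Set ConvexHoles.Plane) (hK : Convex ℝ K) (hKarea : volume K = 1) :
    ∃ u v : ℕ → ℝ, Tendsto u atTop (𝓝 0) ∧ Tendsto v atTop (𝓝 0) ∧
      ConvexHoles.WithHighProbability (fun n => ConvexHoles.uniformSample K n)
        (fun n => {p : Fin n → ConvexHoles.Plane |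
          (1 + u n) * (Real.log n / n) ≤ ConvexHoles.polyMax (Set.range p) ∧
          ConvexHoles.polyMax (Set.range p) ≤ (4 + v n) * (Real.log n / n)}) := by
  obtain ⟨e, he, hlow⟩ := ConvexHoles.exists_tendsto_zero_diagonal _
    fun ε hε => ConvexHoles.tendsto_uniformSample_polyMax_lt hK hKarea hε
  obtain ⟨v, hv, hup⟩ := ConvexHoles.exists_tendsto_zero_diagonal _
    fun ε hε => ConvexHoles.tendsto_uniformSample_polyMax_gt hK hKarea hε
  refine ⟨fun n => -e n, v, by simpa using he.neg, hv, ?_⟩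
  have hsum := hlow.add hup
  rw [add_zero] at hsum
  refine tendsto_of_tendsto_of_tendsto_of_le_of_le tendsto_const_nhds hsum
    (fun _ => zero_le) fun n => ?_
  refine le_trans (measure_mono ?_) (measure_union_le _ _)
  intro p hp
  by_contra hcon
  simp only [Set.mem_union, not_or, Set.mem_compl_iff, not_not] at hcon
  refine hp ⟨?_, hcon.2⟩
  rw [← sub_eq_add_neg]
  exact hcon.1
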